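/- Let $K$ be a field of characteristic $0$ and let $\mathfrak{A}$ be an associative (not necessarily unital) $K$-algebra. Write $[\mathcal{A},\mathcal{B}]=\mathcal{A}\mathcal{B}-\mathcal{B}\mathcal{A}$, $\mathcal{A}\diamond\mathcal{B}=\frac12(\mathcal{A}\mathcal{B}+\mathcal{B}\mathcal{A})$ and, for $k\ge 1$, $$\mathrm{Sym}_k(\mathcal{A}_1,\dots,\mathcal{A}_k)=\frac1{k!}\sum_{\pi\in\Pi_k}\mathcal{A}_{\pi(1)}\mathcal{A}_{\pi(2)}\cdots\mathcal{A}_{\pi(k)},$$ where $\Pi_k$ is the set of all permutations of $k$ objects. Define rational numbers $c_h$, $h\ge1$, by $$c_1=\frac1{12},\qquad c_h=-\frac1{2h+1}\sum_{i=1}^{h-1}c_ic_{h-i}\quad(h>1).$$ For $\mathcal{A}_1,\mathcal{A}_2,\mathcal{B}_1,\dots,\mathcal{B}_k\in\mathfrak{A}$ put $$D_{k,h}(\mathcal{A}_1;\mathcal{A}_2;\mathcal{B}_1,\dots,\mathcal{B}_k)=\sum_{i_1,\dots,i_{2h}}\mathrm{Sym}_{k-2h+1}\big([[\cdots[[\mathcal{A}_1,\mathcal{B}_{i_1}],\mathcal{B}_{i_2}],\dots,\mathcal{B}_{i_{2h}}],\mathcal{A}_2],\,\mathcal{B}_{j_1},\dots,\mathcal{B}_{j_{k-2h}}\big)$$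 for $1\le h\le k/2$, and $$E_{k,h}(\mathcal{A}_1;\mathcal{A}_2;\mathcal{B}_1,\dots,\mathcal{B}_k)=\sum_{i_1,\dots,i_{2h+1}}\mathrm{Sym}_{k-2h+1}\big([\cdots[[\mathcal{A}_1,\mathcal{B}_{i_1}],\mathcal{B}_{i_2}],\dots,\mathcal{B}_{i_{2h}}],\,[\mathcal{A}_2,\mathcal{B}_{i_{2h+1}}],\,\mathcal{B}_{j_1},\dots,\mathcal{B}_{j_{k-2h-1}}\big)$$ for $1\le h\le (k-1)/2$. Both sums run over all ordered tuples of pairwise distinct indices in $\{1,\dots,k\}$, and $j_1,j_2,\dots$ are the remaining indices of $\{1,\dots,k\}$. Below, "$+\ \mathcal{A}_1\leftrightarrow\mathcal{A}_2$" means: add all the preceding terms of the right-hand side with $\mathcal{A}_1$ and $\mathcal{A}_2$ interchanged. For all elements $\mathcal{A}_1,\mathcal{A}_2,\mathcal{B}_1,\mathcal{B}_2,\dots$ of $\mathfrak{A}$ the following hold. (1) Case $k=2$: $$\begin{aligned}{}[\mathcal{A}_1\diamond\mathcal{A}_2,\mathcal{B}_1\diamond\mathcal{B}_2]={}&\ma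thrm{Sym}_3([\mathcal{A}_1,\mathcal{B}_1],\mathcal{A}_2,\mathcal{B}_2)+\mathrm{Sym}_3([\mathcal{A}_1,\mathcal{B}_2],\mathcal{A}_2,\mathcal{B}_1)\\&+\mathrm{Sym}_3([\mathcal{A}_2,\mathcal{B}_1],\mathcal{A}_1,\mathcal{B}_2)+\mathrm{Sym}_3([\mathcal{A}_2,\mathcal{B}_2],\mathcal{A}_1,\mathcal{B}_1)\\&-\tfrac1{12}\big([[[\mathcal{A}_1,\mathcal{B}_1],\mathcal{B}_2],\mathcal{A}_2]+[[[\mathcal{A}_1,\mathcal{B}_2],\mathcal{B}_1],\mathcal{A}_2]\\&\qquad+[[[\mathcal{A}_2,\mathcal{B}_1],\mathcal{B}_2],\mathcal{A}_1]+[[[\mathcal{A}_2,\mathcal{B}_2],\mathcal{B}_1],\mathcal{A}_1]\big).\end{aligned}$$ (2) Case $k=3$: $$\begin{aligned}{}[\mathcal{A}_1\diamond\mathcal{A}_2,\mathrm{Sym}_3(\mathcal{B}_1,\mathcal{B}_2,\mathcal{B}_3)]={}&\mathrm{Sym}_4(\mathcal{A}_1,[\mathcal{A}_2,\mathcal{B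}_1],\mathcal{B}_2,\mathcal{B}_3)+\mathrm{Sym}_4(\mathcal{A}_1,\mathcal{B}_1,[\mathcal{A}_2,\mathcal{B}_2],\mathcal{B}_3)+\mathrm{Sym}_4(\mathcal{A}_1,\mathcal{B}_1,\mathcal{B}_2,[\mathcal{A}_2,\mathcal{B}_3])\\&+\tfrac1{12}\sum_{\pi\in\Pi_3}\big([[\mathcal{A}_1,\mathcal{B}_{\pi(1)}],\mathcal{B}_{\pi(2)}]\diamond[\mathcal{A}_2,\mathcal{B}_{\pi(3)}]-[[[\mathcal{A}_1,\mathcal{B}_{\pi(1)}],\mathcal{B}_{\pi(2)}],\mathcal{A}_2]\diamond\mathcal{B}_{\pi(3)}\big)\\&+\ \mathcal{A}_1\leftrightarrow\mathcal{A}_2.\end{aligned}$$ (3) General formula, for every $k\ge1$: $$\begin{aligned}{}[\mathcal{A}_1\diamond\mathcal{A}_2,\mathrm{Sym}_k(\mathcal{B}_1,\dots,\mathcal{B}_k)]={}&\sum_{i=1}^k\mathrm{Sym}_{k+1}(\mathcal{A}_1,\mathcal{B}_1,\dots,\mathcal{B}_{i-1},[\mathcal{A}_2,\mathcal{B}_i],\mathcal{B}_{i+1},\dots,\mathcal{B}_k)\\&-\sum_{h=1}^{\lfloor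 k/2\rfloor}c_h\,D_{k,h}(\mathcal{A}_1;\mathcal{A}_2;\mathcal{B}_1,\dots,\mathcal{B}_k)+\sum_{h=1}^{\lfloor (k-1)/2\rfloor}c_h\,E_{k,h}(\mathcal{A}_1;\mathcal{A}_2;\mathcal{B}_1,\dots,\mathcal{B}_k)\\&+\ \mathcal{A}_1\leftrightarrow\mathcal{A}_2.\end{aligned}$$ -/

import Mathlib

namespace SymComm

/-- The product `a₁ a₂ ⋯ aₖ` of a nonempty list in a possibly non-unital algebra
(with the junk value `0` on the empty list). -/
def listMul {A : Type*} [NonUnitalRing A] : List A → A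
  | [] => 0
  | [a] => a
  | a :: b :: l => a * listMul (b :: l)

/-- The symmetrized product `Sym_k(a₁, …, aₖ) = (1/k!) ∑_π a_{π(1)} ⋯ a_{π(k)}` of the entries
of the list `[a₁, …, aₖ]`, where `π` runs over all permutations of the `k` positions. -/
def symProd (K : Type*) [Field K] {A : Type*} [NonUnitalRing A] [Module K A]
    (l : List A) : A :=
  ((l.length.factorial : K)⁻¹) •
    ∑ π : Equiv.Perm (Fin l.length), listMul (List.ofFn fun i => l.get (π i))

/-- The symmetrized product `a ◇ b = ½ (a b + b a)` of two elements. -/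
def diamond (K : Type*) [Field K] {A : Type*} [NonUnitalRing A] [Module K A] (a b : A) : A :=
  (1 / 2 : K) • (a * b + b * a)

/-- `a ◇ b = Sym_2(a, b)`. -/
theorem diamond_eq_symProd (K : Type*) [Field K] {A : Type*} [NonUnitalRing A] [Module K A]
    (a b : A) : diamond K a b = symProd K [a, b] := by
  have h : (Finset.univ : Finset (Equiv.Perm (Fin 2))) = {1, Equiv.swap 0 1} := by decide
  have hne : (1 : Equiv.Perm (Fin 2)) ≠ Equiv.swap 0 1 := by decide
  change (1 / 2 : K) • (a * b + b * a) = ((Nat.factorial 2 : ℕ) : K)⁻¹ •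
    ∑ π : Equiv.Perm (Fin 2), listMul (List.ofFn fun i => [a, b].get (π i))
  rw [h, Finset.sum_pair hne]
  simp [listMul, List.ofFn_succ]

/-- The iterated commutator `[…[[a, b₁], b₂], …, bₘ]`, where `l = [b₁, …, bₘ]`. -/
def iterComm {A : Type*} [NonUnitalRing A] (a : A) (l : List A) : A :=
  l.foldl (fun x y => ⁅x, y⁆) a

/-- The list `B_{j₁}, B_{j₂}, …` of those `B_j` whose index `j` is different from all the
indices `i₁, …, iₘ` given by `e`. -/
def remaining {A : Type*} {m k : ℕ} (B : Fin k → A) (e : Fin m ↪ Fin k) : List A :=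
  ((List.finRange k).filter fun j => ∀ r, e r ≠ j).map B

/-- The expression `D_{k,h}(a₁; a₂; B₁, …, Bₖ)`. The indices `(i₁, …, i_{2h})` are pairwise
distinct: they are the values of an injection `e`. -/
noncomputable def termD (K : Type*) [Field K] {A : Type*} [NonUnitalRing A] [Module K A]
    {k : ℕ} (h : ℕ) (a₁ a₂ : A) (B : Fin k → A) : A :=
  ∑ e : Fin (2 * h) ↪ Fin k,
    symProd K (⁅iterComm a₁ (List.ofFn fun r => B (e r)), a₂⁆ :: remaining B e)

/-- The expression `E_{k,h}(a₁; a₂; B₁, …, Bₖ)`. The indices `(i₁, …, i_{2h+1})` are pairwise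
distinct: they are the values of an injection `e`. -/
noncomputable def termE (K : Type*) [Field K] {A : Type*} [NonUnitalRing A] [Module K A]
    {k : ℕ} (h : ℕ) (a₁ a₂ : A) (B : Fin k → A) : A :=
  ∑ e : Fin (2 * h + 1) ↪ Fin k,
    symProd K (iterComm a₁ (List.ofFn fun r : Fin (2 * h) => B (e r.castSucc)) ::
      ⁅a₂, B (e (Fin.last (2 * h)))⁆ :: remaining B e)

/-- The coefficients `c_h`, `h ≥ 1` (with an irrelevant value at `0`). -/
def coeff : ℕ → ℚ
  | 0 => 0
  | 1 => 1 / 12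
  | n + 2 => -(1 / (2 * ((n + 2 : ℕ) : ℚ) + 1)) *
      ∑ i : Fin (n + 1), coeff (i.val + 1) * coeff (n + 1 - i.val)
decreasing_by all_goals omega

theorem coeff_one : coeff 1 = 1 / 12 := by
  rw [coeff]

/-- `c_h = -(1/(2h+1)) ∑_{i=1}^{h-1} c_i c_{h-i}` for `h > 1`. -/
theorem coeff_rec (h : ℕ) (hh : 1 < h) :
    coeff h = -(1 / (2 * (h : ℚ) + 1)) *
      ∑ i ∈ Finset.Icc 1 (h - 1), coeff i * coeff (h - i) := by
  obtain ⟨n, rfl⟩ : ∃ n, h = n + 2 := ⟨h - 2, by omega⟩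
  rw [coeff]
  congr 1
  rw [Fin.sum_univ_eq_sum_range (fun i => coeff (i + 1) * coeff (n + 1 - i)) (n + 1),
    Finset.range_eq_Ico]
  refine Finset.sum_nbij' (fun i => i + 1) (fun j => j - 1) ?_ ?_ ?_ ?_ ?_
  · intro i hi
    simp only [Finset.mem_Ico, Finset.mem_Icc] at *
    omega
  · intro i hi
    simp only [Finset.mem_Ico, Finset.mem_Icc] at *
    omega
  · intro i _
    simp
  · intro i hi
    simp only [Finset.mem_Icc] at hi
    omega
  · intro i _
    congr 2
    omega

end SymComm

/-! ### Generating function of the coefficients: `(t/2) coth (t/2)` -/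

namespace SymComm

open PowerSeries Finset

/-! Both sides of the general formula are additive in each `B i` and invariant under permuting the
`B i`, so in characteristic `0` it suffices to treat `B 0 = ⋯ = b` (`MultiAdditiveOn.eq_zero`).
Passing to the unitization allows powers `b ^ 0`.

On the diagonal every term is a combination of words `b^i u b^j v b^l` with `{u, v} = {a₁, a₂}`.
Encode such a word as the commutative monomial `x^i y^j z^l` (`wordMap`). Bracketing the left letter
with `b` becomes multiplication by `y - x`, bracketing the right letter becomes multiplication by `z
- y`, and symmetrized products become complete homogeneous polynomials. The claim turns into a
polynomial identity for `z^k - x^k` (`pow_sub_pow_eq`).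

These identities for all `k` are the coefficients of one power series identity in `T`
(`exp_sub_exp_eq`), because homogeneous polynomials are the coefficients of divided differences of
`e^{xT}`. The recursion for `c_h` is a Riccati equation that identifies `1 + ∑ c_h t^{2h}` with
`(t/2) coth (t/2)`. This is exactly the factor that turns a divided difference of the exponential
into the mean of its endpoint values. The means over `(x, y)` and `(y, z)` share `e^{yT}`, which
cancels in their difference.

The cases `k = 2, 3` are the general formula with its index sets enumerated. -/

/-- The series `1 + ∑ c_h s^h`. -/
noncomputable def coeffSeries : ℚ⟦X⟧ := mk fun h => if h = 0 then 1 else coeff h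

theorem coeff_coeffSeries_zero : PowerSeries.coeff 0 coeffSeries = 1 := by
  simp [coeffSeries]

theorem coeff_coeffSeries {h : ℕ} (hh : h ≠ 0) : PowerSeries.coeff h coeffSeries = coeff h := by
  simp [coeffSeries, hh]

theorem sum_antidiagonal_coeffSeries {h : ℕ} (hh : 1 ≤ h) :
    ∑ p ∈ antidiagonal h, PowerSeries.coeff p.1 coeffSeries * PowerSeries.coeff p.2 coeffSeries =
      2 * coeff h + ∑ i ∈ Icc 1 (h - 1), coeff i * coeff (h - i) := by
  obtain ⟨n, rfl⟩ : ∃ n, h = n + 1 := ⟨h - 1, by omega⟩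
  rw [Finset.Nat.sum_antidiagonal_eq_sum_range_succ
    (fun i j => PowerSeries.coeff i coeffSeries * PowerSeries.coeff j coeffSeries),
    sum_range_succ, sum_range_succ', Nat.sub_self, Nat.sub_zero, coeff_coeffSeries_zero,
    coeff_coeffSeries (by omega)]
  have : ∑ i ∈ range n, PowerSeries.coeff (i + 1) coeffSeries *
      PowerSeries.coeff (n + 1 - (i + 1)) coeffSeries =
      ∑ i ∈ Icc 1 (n + 1 - 1), coeff i * coeff (n + 1 - i) := by
    rw [range_eq_Ico, Finset.sum_Ico_add'
      (fun i => PowerSeries.coeff i coeffSeries * PowerSeries.coeff (n + 1 - i) coeffSeries) 0 n 1]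
    refine sum_congr (by ext; simp) fun i hi => ?_
    rw [mem_Icc] at hi
    rw [coeff_coeffSeries (by omega), coeff_coeffSeries (by omega)]
  rw [this]
  ring

/-- In the convolution square the constant term `1` contributes `2 c_h`, so comparing coefficients
gives `(2h+1) c_h = -∑ c_i c_{h-i}` for `h > 1`. The term `X / 4` only affects `h = 1`, where it
forces `3 c_1 = 1/4`. -/
theorem coeffSeries_riccati :
    2 * X * d⁄dX ℚ coeffSeries = coeffSeries - coeffSeries * coeffSeries + C (1 / 4) * X := by
  ext h
  rcases h with _ | n
  · simp [coeffSeries]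
  rw [mul_assoc, show (2 : ℚ⟦X⟧) = C 2 from rfl, coeff_C_mul, coeff_succ_X_mul, coeff_derivative,
    map_add, map_sub, PowerSeries.coeff_mul, coeff_C_mul, sum_antidiagonal_coeffSeries (by omega),
    coeff_coeffSeries (by omega)]
  rcases n with _ | n
  · norm_num [coeff_one, PowerSeries.coeff_X]
  · have := coeff_rec (n + 2) (by omega)
    rw [PowerSeries.coeff_X, if_neg (by omega)]
    set S := ∑ i ∈ Icc 1 (n + 2 - 1), coeff i * coeff (n + 2 - i) with hS
    have h2 : (2 * ((n + 2 : ℕ) : ℚ) + 1) * coeff (n + 2) = - S := by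
      rw [this]; field_simp
    push_cast at h2 ⊢
    linear_combination h2

/-- The series `1 + ∑ c_h t^{2h}`, that is `(t/2) coth (t/2)`. -/
noncomputable def cothSeries : ℚ⟦X⟧ := expand 2 two_ne_zero coeffSeries

/-- Under `s = t²` the operator `2 s d/ds` becomes `t d/dt`. -/
theorem cothSeries_riccati :
    X * d⁄dX ℚ cothSeries = cothSeries - cothSeries * cothSeries + C (1 / 4) * X ^ 2 := by
  have h := congrArg (expand 2 two_ne_zero) coeffSeries_riccati
  simp only [map_mul, map_sub, map_add, expand_X, expand_C, map_ofNat] at h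
  unfold cothSeries
  rw [← h]
  conv_lhs => rw [expand_apply, derivative_subst (HasSubst.X_pow two_ne_zero)]
  rw [derivative_pow, derivative_X, ← expand_apply 2 two_ne_zero]
  push_cast
  ring

/-- Since `u` has no constant term, the coefficient of index `n + 1` of `u * w` involves only
earlier coefficients of `w`, while the left side is `n + 1` times the next one. -/
theorem eq_zero_of_X_mul_derivative_eq {u w : ℚ⟦X⟧} (hu : constantCoeff u = 0)
    (hw : constantCoeff w = 0) (h : X * d⁄dX ℚ w = u * w) : w = 0 := by
  ext n
  induction n using Nat.strong_induction_on with
  | _ n ih =>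
    rcases n with _ | n
    · simpa using hw
    have h1 := congrArg (PowerSeries.coeff (n + 1)) h
    rw [coeff_succ_X_mul, coeff_derivative, PowerSeries.coeff_mul, sum_eq_zero] at h1
    · have : ((n : ℚ) + 1) ≠ 0 := by positivity
      simpa [this] using h1
    · rintro ⟨i, j⟩ hij
      rw [HasAntidiagonal.mem_antidiagonal] at hij
      rcases i with _ | i
      · simp [hu]
      · simp only at hij ⊢
        rw [ih j (by omega)]; simp

theorem cothSeries_mul_exp_sub_one :
    cothSeries * (exp ℚ - 1) = C (1 / 2) * X * (exp ℚ + 1) := by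
  rw [← sub_eq_zero]
  -- With `g` the coth series, differentiating `w = g (e^t - 1) - (t/2)(e^t + 1)` and eliminating
  -- `g'` by the Riccati equation leaves `t w' = (1 - g + t/2) w`.
  refine eq_zero_of_X_mul_derivative_eq (u := 1 - cothSeries + C (1 / 2) * X) ?_ ?_ ?_
  · simp [cothSeries, constantCoeff_expand, coeffSeries]
  · simp
  · have e4 : (C (1 / 4) : ℚ⟦X⟧) = C (1 / 2) * C (1 / 2) := by rw [← map_mul]; norm_num
    have e1 : (1 : ℚ⟦X⟧) = 2 * C (1 / 2) := by
      rw [show (2 : ℚ⟦X⟧) = C 2 from rfl, ← map_mul]; norm_num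
    have hr := cothSeries_riccati
    simp only [Derivation.leibniz, map_sub, map_add, derivative_exp, derivative_one, derivative_C,
      derivative_X, smul_eq_mul]
    rw [e4] at hr
    set c : ℚ⟦X⟧ := C (1 / 2)
    set E := exp ℚ
    linear_combination (E - 1) * hr + (X * cothSeries * E - c * X ^ 2 * E) * e1

end SymComm

/-! ### Homogeneous polynomials, divided differences of the exponential, and the identity for `z^k -
x^k` -/

namespace SymComm

open Finset

section Homogeneous

variable {R : Type*} [CommRing R]

/-- The complete homogeneous polynomial of degree `m` in two variables. -/
def homog₂ (x z : R) (m : ℕ) : R := ∑ p ∈ antidiagonal m, x ^ p.1 * z ^ p.2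

/-- The complete homogeneous polynomial of degree `m` in three variables. -/
def homog₃ (x y z : R) (m : ℕ) : R := ∑ p ∈ antidiagonal m, homog₂ x y p.1 * z ^ p.2

theorem homog₂_succ_left (x z : R) (m : ℕ) :
    homog₂ x z (m + 1) = x * homog₂ x z m + z ^ (m + 1) := by
  simp only [homog₂, Finset.Nat.sum_antidiagonal_succ, mul_sum]
  rw [add_comm]
  congr 1
  · exact sum_congr rfl fun p _ => by ring
  · simp

theorem homog₂_succ_right (x z : R) (m : ℕ) :
    homog₂ x z (m + 1) = z * homog₂ x z m + x ^ (m + 1) := by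
  simp only [homog₂, Finset.Nat.sum_antidiagonal_succ', mul_sum]
  rw [add_comm]
  congr 1
  · exact sum_congr rfl fun p _ => by ring
  · simp

theorem homog₃_succ (x y z : R) (m : ℕ) :
    homog₃ x y z (m + 1) = z * homog₃ x y z m + homog₂ x y (m + 1) := by
  simp only [homog₃, Finset.Nat.sum_antidiagonal_succ', mul_sum]
  rw [add_comm]
  congr 1
  · exact sum_congr rfl fun p _ => by ring
  · simp

theorem sub_mul_homog₂ (x z : R) (m : ℕ) :
    (z - x) * homog₂ x z m = z ^ (m + 1) - x ^ (m + 1) := by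
  linear_combination homog₂_succ_left x z m - homog₂_succ_right x z m

theorem sub_mul_homog₃ (x y z : R) (m : ℕ) :
    (z - x) * homog₃ x y z m = homog₂ y z (m + 1) - homog₂ x y (m + 1) := by
  induction m with
  | zero => simp [homog₃, homog₂, Finset.Nat.sum_antidiagonal_succ]; ring
  | succ m ih =>
    rw [homog₃_succ]
    linear_combination z * ih + homog₂_succ_left x y (m + 1) - homog₂_succ_right y z (m + 1)

end Homogeneous

section Series

open PowerSeries

variable {R : Type*} [CommRing R] [Algebra ℚ R]

/-- The exponential series `e^{xT}`. -/
noncomputable def expScaled (x : R) : R⟦X⟧ := rescale x (exp R)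

/-- The series `(pT/2) coth (pT/2)`. -/
noncomputable def cothScaled (p : R) : R⟦X⟧ := rescale p (map (algebraMap ℚ R) cothSeries)

/-- The first divided difference of `e^{xT}`. -/
noncomputable def expDiff₂ (x z : R) : R⟦X⟧ :=
  mk fun m => algebraMap ℚ R ((m + 1).factorial : ℚ)⁻¹ * homog₂ x z m

/-- The second divided difference of `e^{xT}`. -/
noncomputable def expDiff₃ (x y z : R) : R⟦X⟧ :=
  mk fun m => algebraMap ℚ R ((m + 2).factorial : ℚ)⁻¹ * homog₃ x y z m

theorem coeff_expScaled (x : R) (m : ℕ) :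
    PowerSeries.coeff m (expScaled x) = algebraMap ℚ R (m.factorial : ℚ)⁻¹ * x ^ m := by
  simp [expScaled, coeff_rescale, coeff_exp, mul_comm]

theorem X_mul_expDiff₂ (x z : R) :
    C (z - x) * (X * expDiff₂ x z) = expScaled z - expScaled x := by
  ext m
  rw [coeff_C_mul, map_sub, coeff_expScaled, coeff_expScaled]
  rcases m with _ | m
  · simp
  · rw [coeff_succ_X_mul, expDiff₂, coeff_mk]
    linear_combination algebraMap ℚ R ((m + 1).factorial : ℚ)⁻¹ * sub_mul_homog₂ x z m

theorem X_mul_expDiff₃ (x y z : R) :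
    C (z - x) * (X * expDiff₃ x y z) = expDiff₂ y z - expDiff₂ x y := by
  ext m
  rw [coeff_C_mul, map_sub, expDiff₂, expDiff₂, coeff_mk, coeff_mk]
  rcases m with _ | m
  · simp [homog₂]
  · rw [coeff_succ_X_mul, expDiff₃, coeff_mk]
    linear_combination algebraMap ℚ R ((m + 2).factorial : ℚ)⁻¹ * sub_mul_homog₃ x y z m

theorem cothScaled_mul_exp_sub_one (p : R) :
    cothScaled p * (expScaled p - 1) =
      C (algebraMap ℚ R (1 / 2)) * (C p * X) * (expScaled p + 1) := by
  have h := congrArg (fun f => rescale p (map (algebraMap ℚ R) f)) cothSeries_mul_exp_sub_one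
  have hC : rescale p (C (algebraMap ℚ R (1 / 2))) = C (algebraMap ℚ R (1 / 2)) := by
    ext n
    rw [coeff_rescale, coeff_C]
    split_ifs with hn <;> simp [hn]
  simp only [map_mul, map_sub, map_add, map_one, map_exp, map_C, map_X, rescale_X, hC] at h
  exact h

theorem expScaled_add (x y : R) : expScaled (x + y) = expScaled x * expScaled y :=
  (exp_mul_exp_eq_exp_add x y).symm

/-- Only even powers occur in the coth series, which is where the ranges `h ≤ k / 2` and, one degree
lower, `h ≤ (k - 1) / 2` come from. -/
theorem coeff_cothScaled_mul (p : R) (W : R⟦X⟧) (k : ℕ) :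
    PowerSeries.coeff k (cothScaled p * W) = PowerSeries.coeff k W +
      ∑ h ∈ Icc 1 (k / 2), algebraMap ℚ R (coeff h) * p ^ (2 * h) *
        PowerSeries.coeff (k - 2 * h) W := by
  have hc (n : ℕ) : PowerSeries.coeff n (cothScaled p) =
      if 2 ∣ n then p ^ n * algebraMap ℚ R (PowerSeries.coeff (n / 2) coeffSeries) else 0 := by
    rw [cothScaled, coeff_rescale, coeff_map, cothSeries, coeff_expand]
    split_ifs <;> simp
  have h0 : PowerSeries.coeff k W = ∑ h ∈ {0}, algebraMap ℚ R
      (PowerSeries.coeff h coeffSeries) * p ^ (2 * h) * PowerSeries.coeff (k - 2 * h) W := by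
    simp [coeff_coeffSeries_zero]
  have h1 : ∑ h ∈ Icc 1 (k / 2), algebraMap ℚ R (coeff h) * p ^ (2 * h) *
        PowerSeries.coeff (k - 2 * h) W = ∑ h ∈ Icc 1 (k / 2), algebraMap ℚ R
      (PowerSeries.coeff h coeffSeries) * p ^ (2 * h) * PowerSeries.coeff (k - 2 * h) W :=
    sum_congr rfl fun h hh => by rw [coeff_coeffSeries (by rw [mem_Icc] at hh; omega)]
  rw [h1, h0, ← sum_union (by simp), PowerSeries.coeff_mul]
  symm
  refine sum_of_injOn (fun h => (2 * h, k - 2 * h)) ?_ ?_ ?_ ?_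
  · intro a _ b _ hab
    simp only [Prod.mk.injEq] at hab
    omega
  · intro a ha
    simp at ha ⊢
    omega
  · rintro ⟨i, j⟩ hij hn
    rw [hc, if_neg, zero_mul]
    rintro ⟨a, rfl⟩
    simp only [HasAntidiagonal.mem_antidiagonal] at hij
    apply hn
    refine ⟨a, ?_, ?_⟩
    · simp; omega
    · simp; omega
  · intro h _
    rw [hc, if_pos ⟨h, rfl⟩, Nat.mul_div_cancel_left _ two_pos]
    ring

variable [IsDomain R]

/-- This is the property for which the `c_h` are chosen: with `p = y - x`, `(pT/2) coth (pT/2)`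
times `(e^{pT} - 1)/(pT)` is `(e^{pT} + 1)/2`. -/
theorem cothScaled_mul_expDiff₂ {x y : R} (h : y - x ≠ 0) :
    cothScaled (y - x) * expDiff₂ x y =
      C (algebraMap ℚ R (1 / 2)) * (expScaled x + expScaled y) := by
  have hC : (C (y - x) * X : R⟦X⟧) ≠ 0 :=
    mul_ne_zero ((map_ne_zero_iff _ C_injective).2 h) X_ne_zero
  apply mul_left_cancel₀ hC
  have hy : expScaled y = expScaled (y - x) * expScaled x := by
    rw [← expScaled_add, sub_add_cancel]
  have h1 := X_mul_expDiff₂ x y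
  have h2 := cothScaled_mul_exp_sub_one (y - x)
  rw [hy] at h1 ⊢
  linear_combination cothScaled (y - x) * h1 + expScaled x * h2

/-- Let `p = y - x`, `q = z - y`, let `F_p`, `F_q` be the coth series, and write `[x,y]` for a
divided difference of `e^{xT}`. After multiplication by `z - x = p + q`, the right side is `(F_p q +
F_q p)([y,z] - [x,y]) - (F_p - F_q)(q [y,z] + p [x,y])`. The cross terms cancel, leaving `(p +
q)(F_q [y,z] - F_p [x,y])`, a difference of two endpoint means. -/
theorem exp_sub_exp_eq {x y z : R} (hp : y - x ≠ 0) (hq : z - y ≠ 0) (hr : z - x ≠ 0) :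
    C (algebraMap ℚ R (1 / 2)) * (expScaled z - expScaled x) =
      (cothScaled (y - x) * C (z - y) + cothScaled (z - y) * C (y - x)) * (X * expDiff₃ x y z)
        - (cothScaled (y - x) - cothScaled (z - y)) * expDiff₂ x z := by
  apply mul_left_cancel₀ ((map_ne_zero_iff _ C_injective).2 hr : (C (z - x) : R⟦X⟧) ≠ 0)
  have h3 := X_mul_expDiff₃ x y z
  have hxz := X_mul_expDiff₂ x z
  have hxy := X_mul_expDiff₂ x y
  have hyz := X_mul_expDiff₂ y z
  have h2 : C (z - x) * expDiff₂ x z = C (z - y) * expDiff₂ y z + C (y - x) * expDiff₂ x y := by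
    apply mul_left_cancel₀ (X_ne_zero : (X : R⟦X⟧) ≠ 0)
    linear_combination hxz - hxy - hyz
  have hF := cothScaled_mul_expDiff₂ hp
  have hG := cothScaled_mul_expDiff₂ hq
  have hC : (C (z - x) : R⟦X⟧) = C (z - y) + C (y - x) := by rw [← map_add]; ring_nf
  linear_combination
    -(cothScaled (y - x) * C (z - y) + cothScaled (z - y) * C (y - x)) * h3 +
    (cothScaled (y - x) - cothScaled (z - y)) * h2 + C (z - x) * (hF - hG)
    + (cothScaled (z - y) * expDiff₂ y z - cothScaled (y - x) * expDiff₂ x y) * hC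

/-- Coefficient of `T^k` in `exp_sub_exp_eq`. The factor `T` next to the second divided difference
lowers its degree to `k - 1`; the leading `1` of the coth series gives the term without `c_h`, and
cancels in the difference of the two series. -/
theorem pow_sub_pow_eq {x y z : R} (hp : y - x ≠ 0) (hq : z - y ≠ 0) (hr : z - x ≠ 0)
    {k : ℕ} (hk : 1 ≤ k) :
    algebraMap ℚ R ((k.factorial : ℚ)⁻¹ * (1 / 2)) * (z ^ k - x ^ k) =
      algebraMap ℚ R ((k + 1).factorial : ℚ)⁻¹ * ((z - x) * homog₃ x y z (k - 1))
      - ∑ h ∈ Icc 1 (k / 2), algebraMap ℚ R (coeff h * ((k - 2 * h + 1).factorial : ℚ)⁻¹) *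
          (((y - x) ^ (2 * h) - (z - y) ^ (2 * h)) * homog₂ x z (k - 2 * h))
      + ∑ h ∈ Icc 1 ((k - 1) / 2), algebraMap ℚ R (coeff h * ((k - 2 * h + 1).factorial : ℚ)⁻¹) *
          (((y - x) ^ (2 * h) * (z - y) + (z - y) ^ (2 * h) * (y - x)) *
            homog₃ x y z (k - 1 - 2 * h)) := by
  obtain ⟨n, rfl⟩ : ∃ n, k = n + 1 := ⟨k - 1, by omega⟩
  have h := congrArg (PowerSeries.coeff (n + 1)) (exp_sub_exp_eq hp hq hr)
  have e : (cothScaled (y - x) * C (z - y) + cothScaled (z - y) * C (y - x)) *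
      (X * expDiff₃ x y z) =
      C (z - y) * (X * (cothScaled (y - x) * expDiff₃ x y z)) +
      C (y - x) * (X * (cothScaled (z - y) * expDiff₃ x y z)) := by ring
  rw [e, sub_mul, coeff_C_mul, map_sub, map_sub, map_add, coeff_C_mul, coeff_C_mul,
    coeff_succ_X_mul, coeff_succ_X_mul, coeff_cothScaled_mul, coeff_cothScaled_mul,
    sub_mul, map_sub, coeff_cothScaled_mul, coeff_cothScaled_mul, coeff_expScaled, coeff_expScaled] at h
  simp only [expDiff₂, expDiff₃, coeff_mk] at h
  have s1 : ∑ h ∈ Icc 1 ((n + 1) / 2),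
      algebraMap ℚ R (coeff h * ((n + 1 - 2 * h + 1).factorial : ℚ)⁻¹) *
          (((y - x) ^ (2 * h) - (z - y) ^ (2 * h)) * homog₂ x z (n + 1 - 2 * h)) =
      ∑ h ∈ Icc 1 ((n + 1) / 2), algebraMap ℚ R (coeff h) * (y - x) ^ (2 * h) *
        (algebraMap ℚ R ((n + 1 - 2 * h + 1).factorial : ℚ)⁻¹ * homog₂ x z (n + 1 - 2 * h)) -
      ∑ h ∈ Icc 1 ((n + 1) / 2), algebraMap ℚ R (coeff h) * (z - y) ^ (2 * h) *
        (algebraMap ℚ R ((n + 1 - 2 * h + 1).factorial : ℚ)⁻¹ * homog₂ x z (n + 1 - 2 * h)) := by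
    rw [← sum_sub_distrib]
    refine sum_congr rfl fun h _ => ?_
    rw [map_mul]; ring
  have s2 : ∑ h ∈ Icc 1 ((n + 1 - 1) / 2),
      algebraMap ℚ R (coeff h * ((n + 1 - 2 * h + 1).factorial : ℚ)⁻¹) *
          (((y - x) ^ (2 * h) * (z - y) + (z - y) ^ (2 * h) * (y - x)) *
            homog₃ x y z (n + 1 - 1 - 2 * h)) =
      (z - y) * ∑ h ∈ Icc 1 (n / 2), algebraMap ℚ R (coeff h) * (y - x) ^ (2 * h) *
        (algebraMap ℚ R ((n - 2 * h + 2).factorial : ℚ)⁻¹ * homog₃ x y z (n - 2 * h)) +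
      (y - x) * ∑ h ∈ Icc 1 (n / 2), algebraMap ℚ R (coeff h) * (z - y) ^ (2 * h) *
        (algebraMap ℚ R ((n - 2 * h + 2).factorial : ℚ)⁻¹ * homog₃ x y z (n - 2 * h)) := by
    rw [mul_sum, mul_sum, ← sum_add_distrib, Nat.add_sub_cancel]
    refine sum_congr rfl fun h hh => ?_
    rw [mem_Icc] at hh
    rw [show n + 1 - 2 * h + 1 = n - 2 * h + 2 by omega, map_mul]; ring
  rw [s1, s2, map_mul, Nat.add_sub_cancel]
  linear_combination h

end Series

end SymComm

/-! ### Symmetrized products as sums over words -/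

namespace SymComm

open Finset

section Permutations

/-- Permuting positions rather than entries keeps multiplicities when entries coincide, as
`List.permutations'` does. Hence the comparison is made on the duplicate-free list of positions. The
recursive structure of `permutations'` then makes the sums accessible to induction. -/
theorem sum_perm_ofFn {α M : Type*} [AddCommMonoid M] (l : List α) (g : List α → M) :
    ∑ π : Equiv.Perm (Fin l.length), g (List.ofFn fun i => l.get (π i)) =
      (l.permutations'.map g).sum := by
  classical
  have hl : l.permutations' = (List.finRange l.length).permutations'.map (List.map l.get) := by
    rw [List.map_permutations', List.map_get_finRange]
  have hnd : (List.finRange l.length).permutations'.Nodup := by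
    rw [← (List.permutations_perm_permutations' _).nodup_iff]
    exact List.nodup_permutations _ (List.nodup_finRange _)
  rw [hl, List.map_map, ← List.sum_toFinset _ hnd]
  refine Finset.sum_bij (fun π _ => List.ofFn π) ?_ ?_ ?_ ?_
  · intro π _
    rw [List.mem_toFinset, List.mem_permutations', List.ofFn_eq_map]
    exact Equiv.Perm.map_finRange_perm π
  · intro π _ σ _ h
    exact Equiv.coe_fn_injective (List.ofFn_injective h)
  · intro l' h'
    rw [List.mem_toFinset, List.mem_permutations'] at h'
    have hlen : l'.length = l.length := by simpa using h'.length_eq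
    have hnd' : l'.Nodup := h'.nodup_iff.2 (List.nodup_finRange _)
    have hinj : Function.Injective fun i : Fin l.length => l'.get (i.cast hlen.symm) :=
      fun i j hij => by simpa using List.nodup_iff_injective_get.1 hnd' hij
    refine ⟨Equiv.ofBijective _ (Finite.injective_iff_bijective.1 hinj), mem_univ _, ?_⟩
    apply List.ext_get
    · simp [hlen]
    · simp
  · intro π _
    simp [List.map_ofFn, Function.comp_def]

theorem sum_map_flatMap {α β M : Type*} [AddCommMonoid M] (l : List α) (f : α → List β)
    (g : β → M) : ((l.flatMap f).map g).sum = (l.map fun a => ((f a).map g).sum).sum := by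
  induction l with
  | nil => simp
  | cons a l ih => simp [List.flatMap_cons, ih]

theorem permutations'_replicate {α : Type*} (m : ℕ) (b : α) :
    (List.replicate m b).permutations' = List.replicate m.factorial (List.replicate m b) := by
  rw [List.eq_replicate_iff]
  refine ⟨by
    rw [← (List.permutations_perm_permutations' _).length_eq, List.length_permutations,
      List.length_replicate], fun l hl => ?_⟩
  rw [List.mem_permutations'] at hl
  exact List.perm_replicate.1 hl

end Permutations

section NonUnital

variable (K : Type*) [Field K] {A : Type*} [NonUnitalRing A] [Module K A]

theorem symProd_eq_sum_permutations' (l : List A) :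
    symProd K l = ((l.length.factorial : K)⁻¹) • (l.permutations'.map listMul).sum := by
  rw [symProd, sum_perm_ofFn l listMul]

variable {K} in
theorem symProd_perm {l l' : List A} (h : l.Perm l') : symProd K l = symProd K l' := by
  rw [symProd_eq_sum_permutations', symProd_eq_sum_permutations', h.length_eq,
    (h.permutations'.map listMul).sum_eq]

variable {B : Type*} [NonUnitalRing B] [Module K B]

variable {K} in
theorem map_listMul (f : A →ₙₐ[K] B) : ∀ l : List A, f (listMul l) = listMul (l.map f)
  | [] => by simp [listMul]
  | [a] => by simp [listMul]
  | a :: b :: l => by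
    have := map_listMul f (b :: l)
    simp only [List.map_cons] at this ⊢
    rw [listMul, listMul, map_mul, this]

variable {K} in
theorem map_symProd (f : A →ₙₐ[K] B) (l : List A) : f (symProd K l) = symProd K (l.map f) := by
  rw [symProd_eq_sum_permutations', symProd_eq_sum_permutations', List.length_map, map_smul,
    map_list_sum, List.map_map, ← List.map_permutations', List.map_map]
  congr 3
  ext x
  exact map_listMul f x

end NonUnital

section Unital

variable {K : Type*} [Field K] {U : Type*} [Ring U] [Algebra K U]

theorem listMul_eq_prod : ∀ {l : List U}, l ≠ [] → listMul l = l.prod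
  | [a], _ => by simp [listMul]
  | a :: b :: l, _ => by
    rw [listMul, listMul_eq_prod (List.cons_ne_nil b l), List.prod_cons (a := a)]

theorem symProd_eq_sum_prod {l : List U} (hl : l ≠ []) :
    symProd K l = ((l.length.factorial : K)⁻¹) • (l.permutations'.map List.prod).sum := by
  rw [symProd_eq_sum_permutations']
  congr 2
  refine List.map_congr_left fun x hx => listMul_eq_prod ?_
  rintro rfl
  exact hl (List.nil_perm.1 (List.mem_permutations'.1 hx))

/-- The sum of the words `b^i u b^j` with `i + j = m`. -/
def insertSum (b u : U) (m : ℕ) : U := ∑ p ∈ antidiagonal m, b ^ p.1 * u * b ^ p.2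

theorem insertSum_succ (b u : U) (m : ℕ) :
    insertSum b u (m + 1) = u * b ^ (m + 1) + b * insertSum b u m := by
  simp only [insertSum, Finset.Nat.sum_antidiagonal_succ, mul_sum]
  congr 1
  · simp
  · exact sum_congr rfl fun p _ => by rw [pow_succ']; noncomm_ring

theorem sum_permutations'Aux_cons (u v : U) (l : List U) :
    ((List.permutations'Aux u (v :: l)).map List.prod).sum =
      u * v * l.prod + v * ((List.permutations'Aux u l).map List.prod).sum := by
  simp only [List.permutations'Aux, List.map_cons, List.sum_cons, List.map_map, List.prod_cons,
    ← mul_assoc]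
  congr 1
  rw [← List.sum_map_mul_left]
  simp [Function.comp_def]

theorem sum_permutations'Aux_replicate (b u : U) (m : ℕ) :
    ((List.permutations'Aux u (List.replicate m b)).map List.prod).sum = insertSum b u m := by
  induction m with
  | zero => simp [insertSum]
  | succ m ih =>
    rw [List.replicate_succ, sum_permutations'Aux_cons, ih, insertSum_succ, List.prod_replicate,
      mul_assoc, pow_succ']

/-- The sum over all insertions of `v` and then of `u` into the word `b^m`. -/
def insertSum₂ (b u v : U) (m : ℕ) : U :=
  ((List.permutations'Aux v (List.replicate m b)).map fun l =>
    ((List.permutations'Aux u l).map List.prod).sum).sum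

theorem insertSum₂_zero (b u v : U) : insertSum₂ b u v 0 = u * v + v * u := by
  simp [insertSum₂]

/-- Sort the words by their first letter: `b`, `u` or `v`. -/
theorem insertSum₂_succ (b u v : U) (m : ℕ) :
    insertSum₂ b u v (m + 1) =
      b * insertSum₂ b u v m + u * insertSum b v (m + 1) + v * insertSum b u (m + 1) := by
  have h1 : insertSum₂ b u v (m + 1) = (u * v * b ^ (m + 1) + v * insertSum b u (m + 1)) +
      ((List.permutations'Aux v (List.replicate m b)).map fun l =>
        u * b * l.prod + b * ((List.permutations'Aux u l).map List.prod).sum).sum := by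
    rw [insertSum₂, List.replicate_succ, List.permutations'Aux, List.map_cons, List.sum_cons,
      sum_permutations'Aux_cons, ← List.replicate_succ, sum_permutations'Aux_replicate,
      List.prod_replicate, List.map_map]
    congr 3
    ext l
    rw [Function.comp_apply, sum_permutations'Aux_cons]
  rw [h1, List.sum_map_add, List.sum_map_mul_left, List.sum_map_mul_left,
    sum_permutations'Aux_replicate, ← insertSum₂, insertSum_succ b v]
  noncomm_ring

theorem symProd_replicate [CharZero K] (m : ℕ) (hm : m ≠ 0) (b : U) :
    symProd K (List.replicate m b) = b ^ m := by
  rw [symProd_eq_sum_prod (by simpa using hm), permutations'_replicate, List.length_replicate]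
  have : (m.factorial : K) ≠ 0 := Nat.cast_ne_zero.2 m.factorial_ne_zero
  simp [List.map_replicate, List.sum_replicate, ← Nat.cast_smul_eq_nsmul K, smul_smul, this]

theorem symProd_cons_replicate (m : ℕ) (b u : U) :
    symProd K (u :: List.replicate m b) =
      (((m + 1).factorial : K)⁻¹ * m.factorial) • insertSum b u m := by
  rw [symProd_eq_sum_prod (by simp), List.permutations', permutations'_replicate,
    sum_map_flatMap, List.map_replicate, List.sum_replicate, sum_permutations'Aux_replicate,
    List.length_cons, List.length_replicate, ← Nat.cast_smul_eq_nsmul K, smul_smul]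

/-- Each word arises `m!` times, once for every permutation of the equal letters `b`. -/
theorem symProd_cons_cons_replicate (m : ℕ) (b u v : U) :
    symProd K (u :: v :: List.replicate m b) =
      (((m + 2).factorial : K)⁻¹ * m.factorial) • insertSum₂ b u v m := by
  rw [symProd_eq_sum_prod (by simp), List.permutations', List.permutations',
    permutations'_replicate, sum_map_flatMap, sum_map_flatMap, List.map_replicate,
    List.sum_replicate, ← insertSum₂, List.length_cons, List.length_cons, List.length_replicate,
    ← Nat.cast_smul_eq_nsmul K, smul_smul]

end Unital

end SymComm

/-! ### Words as commutative monomials, and the diagonal case -/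

namespace SymComm

open Finset MvPolynomial

/-- Splitting off `x` instead of `z` mirrors splitting off the first letter of a word. -/
theorem homog₃_succ_left {R : Type*} [CommRing R] (x y z : R) (m : ℕ) :
    homog₃ x y z (m + 1) = x * homog₃ x y z m + homog₂ y z (m + 1) := by
  linear_combination homog₃_succ x y z m + sub_mul_homog₃ x y z m

section WordMap

variable (K : Type*) [Field K] {U : Type*} [Ring U] [Algebra K U]

/-- The linear map sending the monomial `x^i y^j z^l` to the word `b^i u b^j v b^l`. -/
noncomputable def wordMap (b u v : U) : MvPolynomial (Fin 3) K →ₗ[K] U :=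
  (basisMonomials (Fin 3) K).constr K fun m => b ^ m 0 * u * b ^ m 1 * v * b ^ m 2

variable {K}

theorem wordMap_monomial (b u v : U) (m : Fin 3 →₀ ℕ) :
    wordMap K b u v (monomial m 1) = b ^ m 0 * u * b ^ m 1 * v * b ^ m 2 := by
  have := (basisMonomials (Fin 3) K).constr_basis K
    (fun m => b ^ m 0 * u * b ^ m 1 * v * b ^ m 2) m
  rwa [coe_basisMonomials] at this

theorem linearMap_ext_monomial {f g : MvPolynomial (Fin 3) K →ₗ[K] U}
    (h : ∀ m, f (monomial m 1) = g (monomial m 1)) : f = g :=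
  (basisMonomials (Fin 3) K).ext fun m => by simpa using h m

theorem X_mul_monomial_one (i : Fin 3) (m : Fin 3 →₀ ℕ) :
    (X i * monomial m 1 : MvPolynomial (Fin 3) K) = monomial (Finsupp.single i 1 + m) 1 := by
  rw [X, monomial_mul, one_mul]

theorem wordMap_X_zero_mul (b u v : U) (p : MvPolynomial (Fin 3) K) :
    wordMap K b u v (X 0 * p) = b * wordMap K b u v p := by
  have : wordMap K b u v ∘ₗ LinearMap.mulLeft K (X 0) =
      LinearMap.mulLeft K b ∘ₗ wordMap K b u v := linearMap_ext_monomial fun m => by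
    simp [X_mul_monomial_one, wordMap_monomial, pow_add, mul_assoc]
  exact LinearMap.congr_fun this p

/-- In `u b - b u` the extra `b` falls either between the two letters, raising the exponent of `X
1`, or before `u`, raising that of `X 0`. -/
theorem wordMap_lie_left (b u v : U) (p : MvPolynomial (Fin 3) K) :
    wordMap K b ⁅u, b⁆ v p = wordMap K b u v ((X 1 - X 0) * p) := by
  have : wordMap K b ⁅u, b⁆ v =
      wordMap K b u v ∘ₗ LinearMap.mulLeft K (X 1 - X 0) := linearMap_ext_monomial fun m => by
    simp only [LinearMap.comp_apply, LinearMap.mulLeft_apply, sub_mul, map_sub,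
      X_mul_monomial_one, wordMap_monomial, Ring.lie_def]
    simp [pow_add, sub_mul, mul_sub, mul_assoc]
    simp only [← mul_assoc, ← pow_succ, ← pow_succ']
  exact LinearMap.congr_fun this p

theorem wordMap_lie_right (b u v : U) (p : MvPolynomial (Fin 3) K) :
    wordMap K b u ⁅v, b⁆ p = wordMap K b u v ((X 2 - X 1) * p) := by
  have : wordMap K b u ⁅v, b⁆ =
      wordMap K b u v ∘ₗ LinearMap.mulLeft K (X 2 - X 1) := linearMap_ext_monomial fun m => by
    simp only [LinearMap.comp_apply, LinearMap.mulLeft_apply, sub_mul, map_sub,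
      X_mul_monomial_one, wordMap_monomial, Ring.lie_def]
    simp [pow_add, sub_mul, mul_sub, mul_assoc]
    simp only [← mul_assoc, ← pow_succ, ← pow_succ']
  exact LinearMap.congr_fun this p

theorem wordMap_iterComm_left (b u v : U) (n : ℕ) (p : MvPolynomial (Fin 3) K) :
    wordMap K b (iterComm u (List.replicate n b)) v p =
      wordMap K b u v ((X 1 - X 0) ^ n * p) := by
  induction n generalizing u with
  | zero => simp [iterComm]
  | succ n ih =>
    rw [List.replicate_succ, iterComm, List.foldl_cons, ← iterComm, ih, wordMap_lie_left]
    ring_nf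

theorem wordMap_iterComm_right (b u v : U) (n : ℕ) (p : MvPolynomial (Fin 3) K) :
    wordMap K b u (iterComm v (List.replicate n b)) p =
      wordMap K b u v ((X 2 - X 1) ^ n * p) := by
  induction n generalizing v with
  | zero => simp [iterComm]
  | succ n ih =>
    rw [List.replicate_succ, iterComm, List.foldl_cons, ← iterComm, ih, wordMap_lie_right]
    ring_nf

theorem wordMap_monomial_mul (b u v : U) (i j l : ℕ) :
    wordMap K b u v (X 0 ^ i * (X 1 ^ j * X 2 ^ l)) = b ^ i * u * b ^ j * v * b ^ l := by
  have : (X 0 ^ i * (X 1 ^ j * X 2 ^ l) : MvPolynomial (Fin 3) K) =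
      monomial (Finsupp.single 0 i + (Finsupp.single 1 j + Finsupp.single 2 l)) 1 := by
    simp [X_pow_eq_monomial, monomial_mul]
  rw [this, wordMap_monomial]
  simp

/-- Without `X 1` the two letters are adjacent, so the two orders combine into their commutator. -/
theorem wordMap_homog₂_sub (b u v : U) (m : ℕ) :
    wordMap K b u v (homog₂ (X 0) (X 2) m) - wordMap K b v u (homog₂ (X 0) (X 2) m) =
      insertSum b ⁅u, v⁆ m := by
  simp only [homog₂, map_sum, insertSum, ← sum_sub_distrib]
  refine sum_congr rfl fun p _ => ?_
  have h1 := wordMap_monomial_mul (K := K) b u v p.1 0 p.2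
  have h2 := wordMap_monomial_mul (K := K) b v u p.1 0 p.2
  simp only [pow_zero, one_mul, mul_one] at h1 h2
  rw [h1, h2, Ring.lie_def]
  noncomm_ring

theorem wordMap_homog₂_one_two (b u v : U) (m : ℕ) :
    wordMap K b u v (homog₂ (X 1) (X 2) m) = u * insertSum b v m := by
  simp only [homog₂, map_sum, insertSum, mul_sum]
  refine sum_congr rfl fun p _ => ?_
  have h1 := wordMap_monomial_mul (K := K) b u v 0 p.1 p.2
  simp only [pow_zero, one_mul] at h1
  rw [h1, mul_assoc, mul_assoc, mul_assoc]

/-- Both sides satisfy the same first-letter recursion; the two summands collect the words with `u`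
before `v` and those with `v` before `u`. -/
theorem wordMap_homog₃_add (b u v : U) (m : ℕ) :
    wordMap K b u v (homog₃ (X 0) (X 1) (X 2) m) +
      wordMap K b v u (homog₃ (X 0) (X 1) (X 2) m) = insertSum₂ b u v m := by
  induction m with
  | zero =>
    have h1 := wordMap_monomial_mul (K := K) b u v 0 0 0
    have h2 := wordMap_monomial_mul (K := K) b v u 0 0 0
    simp only [pow_zero, mul_one, one_mul] at h1 h2
    simp [homog₃, homog₂, h1, h2, insertSum₂_zero]
  | succ m ih =>
    rw [homog₃_succ_left, map_add, map_add, wordMap_X_zero_mul, wordMap_X_zero_mul,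
      wordMap_homog₂_one_two, wordMap_homog₂_one_two, insertSum₂_succ, ← ih]
    noncomm_ring

end WordMap

section Diagonal

variable {K : Type*} [Field K] [CharZero K]

theorem algebraMap_rat_eq_C (q : ℚ) :
    algebraMap ℚ (MvPolynomial (Fin 3) K) q = C (q : K) := by
  rw [IsScalarTower.algebraMap_apply ℚ K (MvPolynomial (Fin 3) K), algebraMap_eq]
  simp

theorem pow_sub_pow_eq_mvPolynomial {k : ℕ} (hk : 1 ≤ k) :
    ((k.factorial : K)⁻¹ * (1 / 2)) • ((X 2 : MvPolynomial (Fin 3) K) ^ k - X 0 ^ k) =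
      ((k + 1).factorial : K)⁻¹ • ((X 2 - X 0) * homog₃ (X 0) (X 1) (X 2) (k - 1))
      - ∑ h ∈ Icc 1 (k / 2), ((coeff h : K) * ((k - 2 * h + 1).factorial : K)⁻¹) •
          (((X 1 - X 0) ^ (2 * h) - (X 2 - X 1) ^ (2 * h)) * homog₂ (X 0) (X 2) (k - 2 * h))
      + ∑ h ∈ Icc 1 ((k - 1) / 2), ((coeff h : K) * ((k - 2 * h + 1).factorial : K)⁻¹) •
          (((X 1 - X 0) ^ (2 * h) * (X 2 - X 1) + (X 2 - X 1) ^ (2 * h) * (X 1 - X 0)) *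
            homog₃ (X 0) (X 1) (X 2) (k - 1 - 2 * h)) := by
  have hne {i j : Fin 3} (hij : i ≠ j) : (X i - X j : MvPolynomial (Fin 3) K) ≠ 0 :=
    sub_ne_zero.2 fun h => hij (X_injective h)
  have h := pow_sub_pow_eq (R := MvPolynomial (Fin 3) K) (x := X 0) (y := X 1) (z := X 2)
    (hne (by decide)) (hne (by decide)) (hne (by decide)) hk
  simp only [algebraMap_rat_eq_C, ← smul_eq_C_mul] at h
  push_cast at h
  exact h

variable {U : Type*} [Ring U] [Algebra K U]

/-- The part of the right-hand side before the interchange, for `B₁ = ⋯ = Bₖ = b`. -/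
noncomputable def diagonalHalf (K : Type*) [Field K] [CharZero K] [Algebra K U]
    (k : ℕ) (a₁ a₂ b : U) : U :=
  (k : K) • symProd K (a₁ :: ⁅a₂, b⁆ :: List.replicate (k - 1) b)
  - ∑ h ∈ Icc 1 (k / 2), (coeff h : K) • (k.descFactorial (2 * h) : K) •
      symProd K (⁅iterComm a₁ (List.replicate (2 * h) b), a₂⁆ :: List.replicate (k - 2 * h) b)
  + ∑ h ∈ Icc 1 ((k - 1) / 2), (coeff h : K) • (k.descFactorial (2 * h + 1) : K) •
      symProd K (iterComm a₁ (List.replicate (2 * h) b) :: ⁅a₂, b⁆ ::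
        List.replicate (k - (2 * h + 1)) b)

/-- In words with `a₂` first, `a₁` is the right letter, so the factors `X 1 - X 0` and `X 2 - X 1`
trade places; the sign of the `D`-terms flips because they come from a commutator with `a₂`. The
factor `k!` appears because the number of injections times `(k - n)!` is `k!`. -/
theorem diagonalHalf_eq {k : ℕ} (hk : 1 ≤ k) (a₁ a₂ b : U) :
    diagonalHalf K k a₁ a₂ b = (k.factorial : K) •
      (wordMap K b a₁ a₂ (((k + 1).factorial : K)⁻¹ •
          ((X 2 - X 1) * homog₃ (X 0) (X 1) (X 2) (k - 1))
        - ∑ h ∈ Icc 1 (k / 2), ((coeff h : K) * ((k - 2 * h + 1).factorial : K)⁻¹) •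
          ((X 1 - X 0) ^ (2 * h) * homog₂ (X 0) (X 2) (k - 2 * h))
        + ∑ h ∈ Icc 1 ((k - 1) / 2), ((coeff h : K) * ((k - 2 * h + 1).factorial : K)⁻¹) •
          ((X 1 - X 0) ^ (2 * h) * (X 2 - X 1) * homog₃ (X 0) (X 1) (X 2) (k - 1 - 2 * h))) +
      wordMap K b a₂ a₁ (((k + 1).factorial : K)⁻¹ •
          ((X 1 - X 0) * homog₃ (X 0) (X 1) (X 2) (k - 1))
        + ∑ h ∈ Icc 1 (k / 2), ((coeff h : K) * ((k - 2 * h + 1).factorial : K)⁻¹) •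
          ((X 2 - X 1) ^ (2 * h) * homog₂ (X 0) (X 2) (k - 2 * h))
        + ∑ h ∈ Icc 1 ((k - 1) / 2), ((coeff h : K) * ((k - 2 * h + 1).factorial : K)⁻¹) •
          ((X 2 - X 1) ^ (2 * h) * (X 1 - X 0) * homog₃ (X 0) (X 1) (X 2) (k - 1 - 2 * h)))) := by
  have hdesc {n : ℕ} (hn : n ≤ k) :
      ((k - n).factorial : K) * (k.descFactorial n : K) = k.factorial := by
    exact_mod_cast Nat.factorial_mul_descFactorial hn
  have t1 : (k : K) • symProd K (a₁ :: ⁅a₂, b⁆ :: List.replicate (k - 1) b) =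
      (k.factorial : K) • ((k + 1).factorial : K)⁻¹ •
        (wordMap K b a₁ a₂ ((X 2 - X 1) * homog₃ (X 0) (X 1) (X 2) (k - 1)) +
          wordMap K b a₂ a₁ ((X 1 - X 0) * homog₃ (X 0) (X 1) (X 2) (k - 1))) := by
    rw [symProd_cons_cons_replicate, ← wordMap_homog₃_add (K := K), wordMap_lie_left,
      wordMap_lie_right, smul_smul, smul_smul, show k - 1 + 2 = k + 1 by omega]
    congr 1
    have := hdesc hk
    rw [Nat.descFactorial_one] at this
    rw [← this]; ring
  have t2 : ∑ h ∈ Icc 1 (k / 2), (coeff h : K) • (k.descFactorial (2 * h) : K) •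
      symProd K (⁅iterComm a₁ (List.replicate (2 * h) b), a₂⁆ :: List.replicate (k - 2 * h) b) =
      (k.factorial : K) • ∑ h ∈ Icc 1 (k / 2),
        ((coeff h : K) * ((k - 2 * h + 1).factorial : K)⁻¹) •
        (wordMap K b a₁ a₂ ((X 1 - X 0) ^ (2 * h) * homog₂ (X 0) (X 2) (k - 2 * h)) -
          wordMap K b a₂ a₁ ((X 2 - X 1) ^ (2 * h) * homog₂ (X 0) (X 2) (k - 2 * h))) := by
    rw [smul_sum]
    refine sum_congr rfl fun h hh => ?_
    rw [mem_Icc] at hh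
    rw [symProd_cons_replicate, ← wordMap_homog₂_sub (K := K), wordMap_iterComm_left,
      wordMap_iterComm_right, smul_smul, smul_smul, smul_smul, ← hdesc (n := 2 * h) (by omega)]
    congr 1
    ring
  have t3 : ∑ h ∈ Icc 1 ((k - 1) / 2), (coeff h : K) • (k.descFactorial (2 * h + 1) : K) •
      symProd K (iterComm a₁ (List.replicate (2 * h) b) :: ⁅a₂, b⁆ ::
        List.replicate (k - (2 * h + 1)) b) =
      (k.factorial : K) • ∑ h ∈ Icc 1 ((k - 1) / 2),
        ((coeff h : K) * ((k - 2 * h + 1).factorial : K)⁻¹) •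
        (wordMap K b a₁ a₂ ((X 1 - X 0) ^ (2 * h) * (X 2 - X 1) *
            homog₃ (X 0) (X 1) (X 2) (k - 1 - 2 * h)) +
          wordMap K b a₂ a₁ ((X 2 - X 1) ^ (2 * h) * (X 1 - X 0) *
            homog₃ (X 0) (X 1) (X 2) (k - 1 - 2 * h))) := by
    rw [smul_sum]
    refine sum_congr rfl fun h hh => ?_
    rw [mem_Icc] at hh
    rw [symProd_cons_cons_replicate, ← wordMap_homog₃_add (K := K), wordMap_iterComm_left,
      wordMap_iterComm_right, wordMap_lie_left, wordMap_lie_right, smul_smul, smul_smul,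
      smul_smul, ← hdesc (n := 2 * h + 1) (by omega),
      show k - (2 * h + 1) + 2 = k - 2 * h + 1 by omega,
      show k - 1 - 2 * h = k - (2 * h + 1) by omega]
    congr 1
    · ring
    · congr 2 <;> ring
  rw [diagonalHalf, t1, t2, t3]
  simp only [map_add, map_sub, map_sum, map_smul, smul_add, smul_sub, sum_add_distrib,
    sum_sub_distrib]
  abel

/-- Neither half alone matches the polynomial identity. After adding the interchanged half, both
letter orders carry the same polynomial, namely the right side of `pow_sub_pow_eq_mvPolynomial`. -/
theorem diagonal_formula {k : ℕ} (hk : 1 ≤ k) (a₁ a₂ b : U) :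
    ⁅diamond K a₁ a₂, b ^ k⁆ = diagonalHalf K k a₁ a₂ b + diagonalHalf K k a₂ a₁ b := by
  have h := pow_sub_pow_eq_mvPolynomial (K := K) hk
  have hw (u v : U) : wordMap K b u v (((k.factorial : K)⁻¹ * (1 / 2)) •
      ((X 2 : MvPolynomial (Fin 3) K) ^ k - X 0 ^ k)) =
      ((k.factorial : K)⁻¹ * (1 / 2)) • (u * v * b ^ k - b ^ k * (u * v)) := by
    have h1 := wordMap_monomial_mul (K := K) b u v k 0 0
    have h2 := wordMap_monomial_mul (K := K) b u v 0 0 k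
    simp only [pow_zero, mul_one, one_mul] at h1 h2
    rw [map_smul, map_sub, h1, h2, mul_assoc (b ^ k)]
  have h12 := hw a₁ a₂
  have h21 := hw a₂ a₁
  rw [h] at h12 h21
  have hL : ⁅diamond K a₁ a₂, b ^ k⁆ = (k.factorial : K) •
      (((k.factorial : K)⁻¹ * (1 / 2)) • (a₁ * a₂ * b ^ k - b ^ k * (a₁ * a₂)) +
        ((k.factorial : K)⁻¹ * (1 / 2)) • (a₂ * a₁ * b ^ k - b ^ k * (a₂ * a₁))) := by
    have : (k.factorial : K) ≠ 0 := Nat.cast_ne_zero.2 k.factorial_ne_zero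
    rw [← smul_add, smul_smul, mul_inv_cancel_left₀ this, diamond, Ring.lie_def, smul_mul_assoc,
      mul_smul_comm, ← smul_sub]
    congr 1
    noncomm_ring
  rw [hL, ← h12, ← h21, diagonalHalf_eq hk, diagonalHalf_eq hk]
  simp only [map_add, map_sub, map_sum, map_smul, smul_add, smul_sub, sum_add_distrib,
    sum_sub_distrib, add_mul, sub_mul]
  abel

end Diagonal

end SymComm

/-! ### Polarization -/

namespace SymComm

open Finset

section Polarization

variable {ι A M : Type*} [DecidableEq ι] [AddCommGroup A] [AddCommGroup M]

/-- `f` is additive in each of the variables in `s` and independent of the others. -/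
structure MultiAdditiveOn (s : Set ι) (f : (ι → A) → M) : Prop where
  map_update_add : ∀ i ∈ s, ∀ (B : ι → A) (x y : A), f (Function.update B i (x + y)) =
    f (Function.update B i x) + f (Function.update B i y)
  map_update : ∀ i ∉ s, ∀ (B : ι → A) (x : A), f (Function.update B i x) = f B

namespace MultiAdditiveOn

theorem const (c : M) : MultiAdditiveOn (∅ : Set ι) fun _ : ι → A => c :=
  ⟨fun _ h => h.elim, fun _ _ _ _ => rfl⟩

theorem proj (i : ι) : MultiAdditiveOn {i} fun B : ι → A => B i := by
  refine ⟨?_, ?_⟩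
  · rintro _ rfl B x y
    simp
  · intro j hj B x
    exact Function.update_of_ne (fun h => hj h.symm) _ _

theorem congr_set {s t : Set ι} {f : (ι → A) → M} (hf : MultiAdditiveOn s f) (h : s = t) :
    MultiAdditiveOn t f := h ▸ hf

theorem add {s : Set ι} {f g : (ι → A) → M} (hf : MultiAdditiveOn s f)
    (hg : MultiAdditiveOn s g) : MultiAdditiveOn s fun B => f B + g B := by
  refine ⟨fun i hi B x y => ?_, fun i hi B x => ?_⟩
  · simp only [hf.map_update_add i hi, hg.map_update_add i hi]; abel
  · simp only [hf.map_update i hi, hg.map_update i hi]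

theorem map {N : Type*} [AddCommGroup N] {s : Set ι} {f : (ι → A) → M}
    (hf : MultiAdditiveOn s f) (φ : M →+ N) : MultiAdditiveOn s fun B => φ (f B) := by
  refine ⟨fun i hi B x y => ?_, fun i hi B x => ?_⟩
  · simp only [hf.map_update_add i hi, map_add]
  · simp only [hf.map_update i hi]

theorem sub {s : Set ι} {f g : (ι → A) → M} (hf : MultiAdditiveOn s f)
    (hg : MultiAdditiveOn s g) : MultiAdditiveOn s fun B => f B - g B := by
  simpa [sub_eq_add_neg] using hf.add (hg.map (-AddMonoidHom.id M))

theorem smul {K : Type*} [DistribSMul K M] {s : Set ι} {f : (ι → A) → M}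
    (hf : MultiAdditiveOn s f) (c : K) : MultiAdditiveOn s fun B => c • f B :=
  hf.map (DistribSMul.toAddMonoidHom M c)

theorem zero (s : Set ι) : MultiAdditiveOn s fun _ : ι → A => (0 : M) :=
  ⟨fun _ _ _ _ _ => by simp, fun _ _ _ _ => rfl⟩

theorem sum {κ : Type*} {s : Set ι} (t : Finset κ) {f : κ → (ι → A) → M}
    (hf : ∀ k ∈ t, MultiAdditiveOn s (f k)) : MultiAdditiveOn s fun B => ∑ k ∈ t, f k B := by
  refine ⟨fun i hi B x y => ?_, fun i hi B x => ?_⟩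
  · rw [← sum_add_distrib]
    exact sum_congr rfl fun k hk => (hf k hk).map_update_add i hi B x y
  · exact sum_congr rfl fun k hk => (hf k hk).map_update i hi B x

theorem listSum {κ : Type*} {s : Set ι} (t : List κ) {f : κ → (ι → A) → M}
    (hf : ∀ k ∈ t, MultiAdditiveOn s (f k)) :
    MultiAdditiveOn s fun B => (t.map fun k => f k B).sum := by
  induction t with
  | nil => simpa using zero s
  | cons k t ih =>
    simp only [List.map_cons, List.sum_cons]
    exact (hf k (by simp)).add (ih fun j hj => hf j (by simp [hj]))

variable {U : Type*} [NonUnitalRing U]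

theorem mul {s t : Set ι} {f g : (ι → A) → U} (hf : MultiAdditiveOn s f)
    (hg : MultiAdditiveOn t g) (h : Disjoint s t) :
    MultiAdditiveOn (s ∪ t) fun B => f B * g B := by
  refine ⟨fun i hi B x y => ?_, fun i hi B x => ?_⟩
  · rcases hi with hi | hi
    · have : i ∉ t := h.notMem_of_mem_left hi
      simp only [hf.map_update_add i hi, hg.map_update i this, add_mul]
    · have : i ∉ s := h.notMem_of_mem_right hi
      simp only [hg.map_update_add i hi, hf.map_update i this, mul_add]
  · rw [Set.mem_union, not_or] at hi
    simp only [hf.map_update i hi.1, hg.map_update i hi.2]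

theorem lie {s t : Set ι} {f g : (ι → A) → U} (hf : MultiAdditiveOn s f)
    (hg : MultiAdditiveOn t g) (h : Disjoint s t) :
    MultiAdditiveOn (s ∪ t) fun B => ⁅f B, g B⁆ := by
  simp only [Ring.lie_def]
  exact (hf.mul hg h).sub ((hg.mul hf h.symm).congr_set (Set.union_comm _ _))

/-- Tracking the exact set of variables of each factor is what makes products tractable: with
disjoint sets, each variable enters exactly one factor. -/
theorem listMul (L : List (Set ι × ((ι → A) → U))) (hne : L ≠ [])
    (hL : ∀ x ∈ L, MultiAdditiveOn x.1 x.2)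
    (hd : L.Pairwise fun x y => Disjoint x.1 y.1) :
    MultiAdditiveOn {i | ∃ x ∈ L, i ∈ x.1} fun B => SymComm.listMul (L.map fun x => x.2 B) := by
  induction L with
  | nil => exact (hne rfl).elim
  | cons x L ih =>
    rcases L with _ | ⟨y, L⟩
    · simpa [SymComm.listMul] using hL x (by simp)
    · rw [List.pairwise_cons] at hd
      have h1 := (hL x (by simp)).mul (ih (by simp) (fun z hz => hL z (by simp [hz])) hd.2)
        (Set.disjoint_left.2 fun i hi ⟨z, hz, hiz⟩ => (hd.1 z hz).notMem_of_mem_left hi hiz)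
      simp only [List.map_cons, SymComm.listMul] at h1 ⊢
      refine h1.congr_set ?_
      ext i
      simp

theorem symProd (K : Type*) [Field K] [Module K U] (L : List (Set ι × ((ι → A) → U)))
    (hne : L ≠ []) (hL : ∀ x ∈ L, MultiAdditiveOn x.1 x.2)
    (hd : L.Pairwise fun x y => Disjoint x.1 y.1) :
    MultiAdditiveOn {i | ∃ x ∈ L, i ∈ x.1} fun B => symProd K (L.map fun x => x.2 B) := by
  simp only [symProd_eq_sum_permutations', List.length_map, ← List.map_permutations',
    List.map_map]
  refine smul (listSum _ fun L' hL' => ?_) _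
  rw [List.mem_permutations'] at hL'
  have := listMul L' (fun h => hne (by subst h; exact List.nil_perm.1 hL'))
    (fun x hx => hL x (hL'.mem_iff.1 hx))
    ((hL'.pairwise_iff fun h => h.symm).2 hd)
  refine this.congr_set ?_
  ext i
  simp [hL'.mem_iff]

theorem iterComm {s : Set ι} {f : (ι → U) → U} (hf : MultiAdditiveOn s f) (l : List ι)
    (hl : l.Nodup) (h : ∀ i ∈ l, i ∉ s) :
    MultiAdditiveOn (s ∪ {i | i ∈ l}) fun B => iterComm (f B) (l.map B) := by
  induction l generalizing s f with
  | nil => simpa [SymComm.iterComm] using hf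
  | cons i l ih =>
    rw [List.nodup_cons] at hl
    have h1 := ih (hf.lie (proj i) (by simpa using h i (by simp))) hl.2 fun j hj => by
      rintro (hs | rfl)
      · exact h j (by simp [hj]) hs
      · exact hl.1 hj
    refine h1.congr_set ?_
    ext j
    simp [or_assoc, or_left_comm]

end MultiAdditiveOn

variable [Fintype ι]

/-- Inclusion–exclusion writes the sum over bijections as an alternating sum, over subsets `t`, of
sums over all maps `r` avoiding `t`. By multilinear expansion each inner sum is `f` at the constant
tuple `∑ j ∉ t, B j`, hence zero. -/
theorem MultiAdditiveOn.sum_perm_eq_zero {f : (ι → A) → M} (hf : MultiAdditiveOn Set.univ f)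
    (h : ∀ b, f (fun _ => b) = 0) (B : ι → A) : ∑ σ : Equiv.Perm ι, f (B ∘ σ) = 0 := by
  let φ (B : ι → A) (i : ι) : A →+ M :=
    AddMonoidHom.mk' (fun x => f (Function.update B i x)) (hf.map_update_add i trivial B)
  -- Additivity already gives linearity over `ℕ`, enough for the expansion lemma `map_sum_finset`.
  let g : MultilinearMap ℕ (fun _ : ι => A) M := MultilinearMap.mk' f
    (fun B i => map_add (φ B i)) (fun B i c x => map_nsmul (φ B i) c x)
  have key := Finset.inclusion_exclusion_sum_inf_compl (univ : Finset ι)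
    (fun i => (univ : Finset (ι → ι)).filter fun r => i ∉ Set.range r) fun r => f (B ∘ r)
  have hz : ∀ t ∈ (univ : Finset ι).powerset, (-1 : ℤ) ^ #t •
      ∑ r ∈ t.inf (fun i => (univ : Finset (ι → ι)).filter fun r => i ∉ Set.range r),
        f (B ∘ r) = 0 := by
    intro t _
    have e : t.inf (fun i => (univ : Finset (ι → ι)).filter fun r => i ∉ Set.range r) =
        Fintype.piFinset fun _ : ι => tᶜ := by
      ext r
      simp only [Finset.mem_inf, mem_filter, mem_univ, true_and, Set.mem_range, not_exists,
        Fintype.mem_piFinset, mem_compl]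
      exact ⟨fun H j hj => H _ hj j rfl, fun H i hi j hj => H j (hj ▸ hi)⟩
    have := g.map_sum_finset (fun _ j => B j) (fun _ => tᶜ)
    rw [e]
    refine (congrArg _ (this.symm.trans (h _))).trans (smul_zero _)
  rw [sum_eq_zero hz] at key
  rw [← key]
  -- The maps that miss no index are the surjections, which on a finite type are the permutations.
  refine sum_bij (fun σ _ => ⇑σ) ?_ ?_ ?_ ?_
  · intro σ _
    suffices ∀ i, ∃ x, σ x = i by simpa [Finset.mem_inf]
    exact σ.surjective
  · intro σ _ τ _ hστ
    exact Equiv.coe_fn_injective hστ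
  · intro r hr
    have hs : Function.Surjective r := fun i => by
      have := Finset.mem_inf.1 hr i (mem_univ i)
      simpa using this
    exact ⟨Equiv.ofBijective r (Finite.surjective_iff_bijective.1 hs), mem_univ _, rfl⟩
  · intros; rfl

theorem MultiAdditiveOn.eq_zero {K : Type*} [Field K] [CharZero K] [Module K M]
    {f : (ι → A) → M} (hf : MultiAdditiveOn Set.univ f) (h : ∀ b, f (fun _ => b) = 0)
    (hs : ∀ (σ : Equiv.Perm ι) (B : ι → A), f (B ∘ σ) = f B) (B : ι → A) : f B = 0 := by
  have h1 := hf.sum_perm_eq_zero h B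
  simp only [hs, sum_const, card_univ, Fintype.card_perm, ← Nat.cast_smul_eq_nsmul K] at h1
  exact (smul_eq_zero.1 h1).resolve_left (Nat.cast_ne_zero.2 (Nat.factorial_ne_zero _))

end Polarization

end SymComm

/-! ### Multiadditivity, symmetry and naturality of both sides; the general formula -/

namespace SymComm

open Finset

section Multilinear

variable {K : Type*} [Field K] {A : Type*} [NonUnitalRing A] [Module K A] {k : ℕ}

theorem nodup_remainingIndices {m : ℕ} (e : Fin m ↪ Fin k) :
    ((List.finRange k).filter fun j => ∀ r, e r ≠ j).Nodup :=
  (List.nodup_finRange k).filter _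

/-- The entries of `L` use exactly the indices in the range of `e` and `remaining` supplies all
others, so every variable occurs exactly once. -/
theorem multiAdditiveOn_symProd_remaining {m : ℕ} (e : Fin m ↪ Fin k)
    (L : List (Set (Fin k) × ((Fin k → A) → A))) (hne : L ≠ [])
    (hL : ∀ x ∈ L, MultiAdditiveOn x.1 x.2)
    (hd : L.Pairwise fun x y => Disjoint x.1 y.1) (hr : ∀ i, (∃ x ∈ L, i ∈ x.1) ↔ ∃ r, e r = i) :
    MultiAdditiveOn Set.univ fun B => symProd K ((L.map fun x => x.2 B) ++ remaining B e) := by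
  have h := MultiAdditiveOn.symProd K
    (L ++ ((List.finRange k).filter fun j => ∀ r, e r ≠ j).map fun j =>
      (({j} : Set (Fin k)), fun B : Fin k → A => B j)) (by simp [hne]) ?_ ?_
  · simp only [List.map_append, List.map_map, Function.comp_def] at h
    refine h.congr_set (Set.eq_univ_of_forall fun i => ?_)
    by_cases hi : ∃ r, e r = i
    · obtain ⟨x, hx, hix⟩ := (hr i).2 hi
      exact ⟨x, by simp [hx], hix⟩
    · exact ⟨({i}, fun B => B i), by simpa using Or.inr (not_exists.1 hi), rfl⟩
  · intro x hx
    rw [List.mem_append] at hx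
    rcases hx with hx | hx
    · exact hL x hx
    · obtain ⟨j, -, rfl⟩ := List.mem_map.1 hx
      exact .proj j
  · rw [List.pairwise_append]
    refine ⟨hd, ?_, ?_⟩
    · rw [List.pairwise_map]
      exact (nodup_remainingIndices e).imp fun h => by simpa using h
    · intro x hx y hy
      obtain ⟨j, hj, rfl⟩ := List.mem_map.1 hy
      rw [Set.disjoint_singleton_right]
      intro hjx
      obtain ⟨r, hr'⟩ := (hr j).1 ⟨x, hx, hjx⟩
      have := (List.mem_filter.1 hj).2
      simp only [decide_eq_true_eq] at this
      exact this r hr'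

theorem multiAdditiveOn_termD (h : ℕ) (a₁ a₂ : A) :
    MultiAdditiveOn Set.univ fun B : Fin k → A => termD K h a₁ a₂ B := by
  refine .sum _ fun e _ => ?_
  have h1 := ((MultiAdditiveOn.const (ι := Fin k) (A := A) a₁).iterComm (List.ofFn e)
    (List.nodup_ofFn.2 e.injective) (by simp)).lie (.const a₂) (by simp)
  have := multiAdditiveOn_symProd_remaining (K := K) e [(_, _)] (by simp)
    (by simpa using h1) (by simp) (fun i => by simp)
  simpa [List.map_ofFn, Function.comp_def] using this

theorem multiAdditiveOn_termE (h : ℕ) (a₁ a₂ : A) :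
    MultiAdditiveOn Set.univ fun B : Fin k → A => termE K h a₁ a₂ B := by
  refine .sum _ fun e _ => ?_
  have hinj : Function.Injective fun r : Fin (2 * h) => e r.castSucc :=
    e.injective.comp (Fin.castSucc_injective _)
  have h1 := (MultiAdditiveOn.const (ι := Fin k) (A := A) a₁).iterComm
    (List.ofFn fun r : Fin (2 * h) => e r.castSucc) (List.nodup_ofFn.2 hinj) (by simp)
  have h2 := (MultiAdditiveOn.const (ι := Fin k) (A := A) a₂).lie
    (.proj (e (Fin.last (2 * h)))) (by simp)
  have := multiAdditiveOn_symProd_remaining (K := K) e [(_, _), (_, _)] (by simp)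
    (by simpa using ⟨h1, h2⟩) (by simp [Fin.castSucc_ne_last])
    (fun i => by simp [Fin.exists_fin_succ', eq_comm])
  simpa [List.map_ofFn, Function.comp_def] using this

theorem multiAdditiveOn_symProd_update (a₁ a₂ : A) (i : Fin k) :
    MultiAdditiveOn Set.univ fun B : Fin k → A =>
      symProd K (a₁ :: List.ofFn (Function.update B i ⁅a₂, B i⁆)) := by
  have h := MultiAdditiveOn.symProd K
    ((∅, fun _ : Fin k → A => a₁) :: (List.finRange k).map fun j =>
      (({j} : Set (Fin k)), fun B : Fin k → A => Function.update B i ⁅a₂, B i⁆ j))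
    (by simp) ?_ ?_
  · simp only [List.map_cons, ← List.ofFn_eq_map, List.map_ofFn, Function.comp_def] at h
    refine h.congr_set (Set.eq_univ_of_forall fun j => ?_)
    exact ⟨({j}, fun B => Function.update B i ⁅a₂, B i⁆ j), by simp, rfl⟩
  · intro x hx
    rw [List.mem_cons] at hx
    rcases hx with rfl | hx
    · exact .const a₁
    · obtain ⟨j, -, rfl⟩ := List.mem_map.1 hx
      by_cases hj : j = i
      · subst hj
        simpa using (MultiAdditiveOn.const (ι := Fin k) (A := A) a₂).lie (.proj j) (by simp)
      · simpa [Function.update_of_ne hj] using MultiAdditiveOn.proj (A := A) j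
  · rw [List.pairwise_cons, List.pairwise_map]
    exact ⟨by simp, (List.nodup_finRange k).imp fun h => by simpa using h⟩

theorem multiAdditiveOn_symProd_ofFn (hk : 1 ≤ k) :
    MultiAdditiveOn Set.univ fun B : Fin k → A => symProd K (List.ofFn B) := by
  have h := MultiAdditiveOn.symProd K ((List.finRange k).map fun j =>
      (({j} : Set (Fin k)), fun B : Fin k → A => B j))
    (by simp; omega) (by simp [MultiAdditiveOn.proj])
    (by
      rw [List.pairwise_map]
      exact (List.nodup_finRange k).imp fun h => by simpa using h)
  simp only [← List.ofFn_eq_map, List.map_ofFn, Function.comp_def] at h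
  refine h.congr_set (Set.eq_univ_of_forall fun j => ?_)
  exact ⟨({j}, fun B => B j), by simp, rfl⟩

end Multilinear

section HalfSide

variable (K : Type*) [Field K] {A : Type*} [NonUnitalRing A] [Module K A] {k : ℕ}

/-- The terms of the general formula that precede the interchange of `a₁` and `a₂`. -/
noncomputable def halfSide (a₁ a₂ : A) (B : Fin k → A) : A :=
  ∑ i : Fin k, symProd K (a₁ :: List.ofFn (Function.update B i ⁅a₂, B i⁆))
    - ∑ h ∈ Finset.Icc 1 (k / 2), (coeff h : K) • termD K h a₁ a₂ B
    + ∑ h ∈ Finset.Icc 1 ((k - 1) / 2), (coeff h : K) • termE K h a₁ a₂ B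

theorem multiAdditiveOn_halfSide (a₁ a₂ : A) :
    MultiAdditiveOn Set.univ fun B : Fin k → A => halfSide K a₁ a₂ B :=
  ((MultiAdditiveOn.sum _ fun i _ => multiAdditiveOn_symProd_update a₁ a₂ i).sub
    (.sum _ fun h _ => (multiAdditiveOn_termD h a₁ a₂).smul _)).add
    (.sum _ fun h _ => (multiAdditiveOn_termE h a₁ a₂).smul _)

variable {K}

/-- Filtering always lists indices in increasing order, so the two lists agree only up to
reordering, which `symProd` does not see. -/
theorem remaining_comp_perm {α : Type*} {m : ℕ} (B : Fin k → α) (σ : Equiv.Perm (Fin k))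
    (e : Fin m ↪ Fin k) :
    (remaining (B ∘ σ) e).Perm (remaining B (e.trans σ.toEmbedding)) := by
  rw [remaining, remaining, ← List.map_map]
  refine List.Perm.map B ?_
  rw [List.perm_ext_iff_of_nodup ((nodup_remainingIndices e).map σ.injective)
    (nodup_remainingIndices _)]
  intro j
  obtain ⟨i, rfl⟩ := σ.surjective j
  simp [σ.injective.eq_iff]

/-- Postcomposition of embeddings with a permutation. -/
def embeddingTransPerm (m : ℕ) (σ : Equiv.Perm (Fin k)) :
    (Fin m ↪ Fin k) ≃ (Fin m ↪ Fin k) :=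
  Equiv.embeddingCongr (Equiv.refl _) σ

theorem termD_comp_perm (h : ℕ) (a₁ a₂ : A) (σ : Equiv.Perm (Fin k)) (B : Fin k → A) :
    termD K h a₁ a₂ (B ∘ σ) = termD K h a₁ a₂ B :=
  Fintype.sum_equiv (embeddingTransPerm _ σ) _ _ fun e =>
    symProd_perm ((remaining_comp_perm B σ e).cons _)

theorem termE_comp_perm (h : ℕ) (a₁ a₂ : A) (σ : Equiv.Perm (Fin k)) (B : Fin k → A) :
    termE K h a₁ a₂ (B ∘ σ) = termE K h a₁ a₂ B :=
  Fintype.sum_equiv (embeddingTransPerm _ σ) _ _ fun e =>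
    symProd_perm (((remaining_comp_perm B σ e).cons _).cons _)

theorem symProd_ofFn_comp_perm (σ : Equiv.Perm (Fin k)) (B : Fin k → A) :
    symProd K (List.ofFn (B ∘ σ)) = symProd K (List.ofFn B) :=
  symProd_perm (Equiv.Perm.ofFn_comp_perm σ B)

theorem halfSide_comp_perm (a₁ a₂ : A) (σ : Equiv.Perm (Fin k)) (B : Fin k → A) :
    halfSide K a₁ a₂ (B ∘ σ) = halfSide K a₁ a₂ B := by
  have h : ∑ i : Fin k, symProd K (a₁ :: List.ofFn
        (Function.update (B ∘ σ) i ⁅a₂, (B ∘ σ) i⁆)) =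
      ∑ i : Fin k, symProd K (a₁ :: List.ofFn (Function.update B i ⁅a₂, B i⁆)) := by
    refine Fintype.sum_equiv σ _ _ fun i => symProd_perm (List.Perm.cons _ ?_)
    have : Function.update (B ∘ σ) i ⁅a₂, (B ∘ σ) i⁆ =
        Function.update B (σ i) ⁅a₂, B (σ i)⁆ ∘ σ := by
      rw [Function.update_comp_eq_of_injective _ σ.injective]
      rfl
    rw [this]
    exact Equiv.Perm.ofFn_comp_perm σ _
  simp only [halfSide, h, termD_comp_perm, termE_comp_perm]

variable {A' : Type*} [NonUnitalRing A'] [Module K A']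

theorem map_lie_nonUnital (f : A →ₙₐ[K] A') (a b : A) : f ⁅a, b⁆ = ⁅f a, f b⁆ := by
  simp [Ring.lie_def]

theorem map_iterComm (f : A →ₙₐ[K] A') (a : A) (l : List A) :
    f (iterComm a l) = iterComm (f a) (l.map f) := by
  induction l generalizing a with
  | nil => rfl
  | cons b l ih =>
    simpa [iterComm, map_lie_nonUnital] using ih ⁅a, b⁆

theorem map_remaining (f : A →ₙₐ[K] A') {m : ℕ} (B : Fin k → A) (e : Fin m ↪ Fin k) :
    (remaining B e).map f = remaining (f ∘ B) e := by
  rw [remaining, remaining, List.map_map]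

theorem map_termD (f : A →ₙₐ[K] A') (h : ℕ) (a₁ a₂ : A) (B : Fin k → A) :
    f (termD K h a₁ a₂ B) = termD K h (f a₁) (f a₂) (f ∘ B) := by
  simp [termD, map_symProd, map_lie_nonUnital, map_iterComm, map_remaining, List.map_ofFn,
    Function.comp_def]

theorem map_termE (f : A →ₙₐ[K] A') (h : ℕ) (a₁ a₂ : A) (B : Fin k → A) :
    f (termE K h a₁ a₂ B) = termE K h (f a₁) (f a₂) (f ∘ B) := by
  simp [termE, map_symProd, map_lie_nonUnital, map_iterComm, map_remaining, List.map_ofFn,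
    Function.comp_def]

theorem map_halfSide (f : A →ₙₐ[K] A') (a₁ a₂ : A) (B : Fin k → A) :
    f (halfSide K a₁ a₂ B) = halfSide K (f a₁) (f a₂) (f ∘ B) := by
  simp [halfSide, map_termD, map_termE, map_symProd, List.map_ofFn, Function.comp_update,
    map_lie_nonUnital]

theorem map_diamond (f : A →ₙₐ[K] A') (a b : A) :
    f (diamond K a b) = diamond K (f a) (f b) := by
  simp [diamond]

theorem remaining_const {α : Type*} (b : α) {m : ℕ} (e : Fin m ↪ Fin k) :
    remaining (fun _ => b) e = List.replicate (k - m) b := by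
  rw [remaining, List.map_const', ← List.toFinset_card_of_nodup (nodup_remainingIndices e)]
  congr 1
  have : ((List.finRange k).filter fun j => ∀ r, e r ≠ j).toFinset = (univ.map e)ᶜ := by
    ext j
    simp
  rw [this, card_compl, card_map, card_univ, Fintype.card_fin, Fintype.card_fin]

theorem termD_const (h : ℕ) (a₁ a₂ b : A) :
    termD K h a₁ a₂ (fun _ : Fin k => b) = (k.descFactorial (2 * h) : K) •
      symProd K (⁅iterComm a₁ (List.replicate (2 * h) b), a₂⁆ ::
        List.replicate (k - 2 * h) b) := by
  simp only [termD, remaining_const, List.ofFn_const, sum_const, card_univ,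
    Fintype.card_embedding_eq, Fintype.card_fin, ← Nat.cast_smul_eq_nsmul K]

theorem termE_const (h : ℕ) (a₁ a₂ b : A) :
    termE K h a₁ a₂ (fun _ : Fin k => b) = (k.descFactorial (2 * h + 1) : K) •
      symProd K (iterComm a₁ (List.replicate (2 * h) b) :: ⁅a₂, b⁆ ::
        List.replicate (k - (2 * h + 1)) b) := by
  simp only [termE, remaining_const, List.ofFn_const, sum_const, card_univ,
    Fintype.card_embedding_eq, Fintype.card_fin, ← Nat.cast_smul_eq_nsmul K]

theorem ofFn_update_const_perm {α : Type*} (b c : α) (i : Fin k) :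
    (List.ofFn (Function.update (fun _ => b) i c)).Perm (c :: List.replicate (k - 1) b) := by
  rw [List.ofFn_eq_map]
  have h := (List.perm_cons_erase (List.mem_finRange i)).map (Function.update (fun _ => b) i c)
  rw [List.map_cons, Function.update_self] at h
  refine h.trans (List.Perm.of_eq ?_)
  congr 1
  rw [List.eq_replicate_iff]
  refine ⟨by simp, fun x hx => ?_⟩
  obtain ⟨j, hj, rfl⟩ := List.mem_map.1 hx
  rw [(List.nodup_finRange k).mem_erase_iff] at hj
  rw [Function.update_of_ne hj.1]

theorem halfSide_const [CharZero K] {U : Type*} [Ring U] [Algebra K U] (a₁ a₂ b : U) :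
    halfSide K a₁ a₂ (fun _ : Fin k => b) = diagonalHalf K k a₁ a₂ b := by
  have h (i : Fin k) := symProd_perm (K := K) ((ofFn_update_const_perm b ⁅a₂, b⁆ i).cons a₁)
  simp only [halfSide, diagonalHalf, h, termD_const, termE_const, sum_const, card_univ,
    Fintype.card_fin, ← Nat.cast_smul_eq_nsmul K]

variable [CharZero K] [IsScalarTower K A A] [SMulCommClass K A A]

theorem lie_diamond_symProd (hk : 1 ≤ k) (a₁ a₂ : A) (B : Fin k → A) :
    ⁅diamond K a₁ a₂, symProd K (List.ofFn B)⁆ = halfSide K a₁ a₂ B + halfSide K a₂ a₁ B := by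
  rw [← sub_eq_zero]
  refine MultiAdditiveOn.eq_zero (K := K) (ι := Fin k)
    (f := fun B => ⁅diamond K a₁ a₂, symProd K (List.ofFn B)⁆ -
      (halfSide K a₁ a₂ B + halfSide K a₂ a₁ B)) ?_ ?_ ?_ B
  · have h := (MultiAdditiveOn.const (ι := Fin k) (A := A) (diamond K a₁ a₂)).lie
      (multiAdditiveOn_symProd_ofFn (K := K) hk) (by simp)
    exact (h.congr_set (by simp)).sub
      ((multiAdditiveOn_halfSide K a₁ a₂).add (multiAdditiveOn_halfSide K a₂ a₁))
  · intro b
    -- The word calculus needs a unit, so the diagonal case is checked in the unitization and pulled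
    -- back along the injective inclusion.
    let f : A →ₙₐ[K] Unitization K A := Unitization.inrNonUnitalAlgHom K A
    have hf : Function.Injective f := Unitization.inr_injective
    apply hf
    have h := diagonal_formula (K := K) hk (f a₁) (f a₂) (f b)
    -- This uses `k ≠ 0`: the empty `symProd` is the junk value `0`, not `b ^ 0 = 1`.
    rw [← symProd_replicate (K := K) k (by omega), ← halfSide_const, ← halfSide_const] at h
    rw [map_sub, map_add, map_lie_nonUnital, map_diamond, map_symProd, map_halfSide,
      map_halfSide, List.ofFn_const, List.map_replicate, map_zero, sub_eq_zero]
    exact h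
  · intro σ B
    simp only [symProd_ofFn_comp_perm, halfSide_comp_perm]

end HalfSide

end SymComm

/-! ### Explicit terms for `k = 2` and `k = 3` -/

namespace SymComm

open Finset

section LowDegree

variable {K : Type*} [Field K] {A : Type*} [NonUnitalRing A] [Module K A]

theorem symProd_singleton (a : A) : symProd K [a] = a := by
  simp [symProd_eq_sum_permutations', listMul]

theorem sum_perm_two {M : Type*} [AddCommMonoid M] (g : Equiv.Perm (Fin 2) → M) :
    ∑ π, g π = g 1 + g (Equiv.swap 0 1) := by
  have h : (Finset.univ : Finset (Equiv.Perm (Fin 2))) = {1, Equiv.swap 0 1} := by decide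
  rw [h, sum_pair (by decide)]

theorem termD_one_two (a₁ a₂ : A) (B : Fin 2 → A) :
    termD K 1 a₁ a₂ B = ⁅⁅⁅a₁, B 0⁆, B 1⁆, a₂⁆ + ⁅⁅⁅a₁, B 1⁆, B 0⁆, a₂⁆ := by
  have h := Fintype.sum_equiv (Equiv.embeddingEquivOfFinite (Fin 2)).symm
    (fun π => ⁅⁅⁅a₁, B (π 0)⁆, B (π 1)⁆, a₂⁆)
    (fun e : Fin (2 * 1) ↪ Fin 2 =>
      symProd K (⁅iterComm a₁ (List.ofFn fun r => B (e r)), a₂⁆ :: remaining B e)) fun π => by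
    have hr : remaining B ((Equiv.embeddingEquivOfFinite (Fin 2)).symm π) = [] := by
      have : ∀ π : Equiv.Perm (Fin 2),
          ((List.finRange 2).filter fun j => ∀ r, π r ≠ j) = [] := by decide
      exact congrArg (List.map B) (this π)
    exact (symProd_singleton _).symm.trans (congrArg (fun l => symProd K (_ :: l)) hr.symm)
  rw [termD, ← h, sum_perm_two]
  rfl

theorem termE_one_three (a₁ a₂ : A) (B : Fin 3 → A) :
    termE K 1 a₁ a₂ B = ∑ π : Equiv.Perm (Fin 3),
      diamond K ⁅⁅a₁, B (π 0)⁆, B (π 1)⁆ ⁅a₂, B (π 2)⁆ := by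
  symm
  refine Fintype.sum_equiv (Equiv.embeddingEquivOfFinite (Fin 3)).symm _ _ fun π => ?_
  have hr : remaining B ((Equiv.embeddingEquivOfFinite (Fin 3)).symm π) = [] := by
    have : ∀ π : Equiv.Perm (Fin 3),
        ((List.finRange 3).filter fun j => ∀ r, π r ≠ j) = [] := by decide
    exact congrArg (List.map B) (this π)
  exact (diamond_eq_symProd K _ _).trans (congrArg (fun l => symProd K (_ :: _ :: l)) hr.symm)

theorem termD_one_three (a₁ a₂ : A) (B : Fin 3 → A) :
    termD K 1 a₁ a₂ B = ∑ π : Equiv.Perm (Fin 3),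
      diamond K ⁅⁅⁅a₁, B (π 0)⁆, B (π 1)⁆, a₂⁆ (B (π 2)) := by
  symm
  -- An injection of two indices into three extends uniquely to a permutation, whose last value is
  -- the remaining index.
  let φ (π : Equiv.Perm (Fin 3)) : Fin 2 ↪ Fin 3 := (Fin.castSuccEmb).trans π.toEmbedding
  have hφ : Function.Bijective φ := by
    rw [Fintype.bijective_iff_injective_and_card, Fintype.card_perm, Fintype.card_embedding_eq]
    refine ⟨fun π σ h => ?_, by decide⟩
    have : ∀ π σ : Equiv.Perm (Fin 3), π 0 = σ 0 → π 1 = σ 1 → π = σ := by decide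
    exact this π σ (DFunLike.congr_fun h 0) (DFunLike.congr_fun h 1)
  refine Fintype.sum_bijective φ hφ _ _ fun π => ?_
  have hr : remaining B (φ π) = [B (π 2)] := by
    have : ∀ π : Equiv.Perm (Fin 3),
        ((List.finRange 3).filter fun j => ∀ r : Fin 2, π r.castSucc ≠ j) = [π 2] := by decide
    exact congrArg (List.map B) (this π)
  exact (diamond_eq_symProd K _ _).trans (congrArg (fun l => symProd K (_ :: l)) hr.symm)

end LowDegree

end SymComm

theorem mainTheorem7 {K : Type*} [Field K] [CharZero K] {A : Type*} [NonUnitalRing A]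
    [Module K A] [IsScalarTower K A A] [SMulCommClass K A A] (a₁ a₂ : A) :
    -- the case `k = 2`
    (∀ b₁ b₂ : A,
      ⁅SymComm.diamond K a₁ a₂, SymComm.diamond K b₁ b₂⁆ =
        SymComm.symProd K [⁅a₁, b₁⁆, a₂, b₂] + SymComm.symProd K [⁅a₁, b₂⁆, a₂, b₁]
        + SymComm.symProd K [⁅a₂, b₁⁆, a₁, b₂] + SymComm.symProd K [⁅a₂, b₂⁆, a₁, b₁]
        - (1 / 12 : K) •
          (⁅⁅⁅a₁, b₁⁆, b₂⁆, a₂⁆ + ⁅⁅⁅a₁, b₂⁆, b₁⁆, a₂⁆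
            + ⁅⁅⁅a₂, b₁⁆, b₂⁆, a₁⁆ + ⁅⁅⁅a₂, b₂⁆, b₁⁆, a₁⁆)) ∧
    -- the case `k = 3`
    (∀ B : Fin 3 → A,
      ⁅SymComm.diamond K a₁ a₂, SymComm.symProd K [B 0, B 1, B 2]⁆ =
        (SymComm.symProd K [a₁, ⁅a₂, B 0⁆, B 1, B 2]
          + SymComm.symProd K [a₁, B 0, ⁅a₂, B 1⁆, B 2]
          + SymComm.symProd K [a₁, B 0, B 1, ⁅a₂, B 2⁆]
          + (1 / 12 : K) • ∑ π : Equiv.Perm (Fin 3),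
            (SymComm.diamond K ⁅⁅a₁, B (π 0)⁆, B (π 1)⁆ ⁅a₂, B (π 2)⁆
              - SymComm.diamond K ⁅⁅⁅a₁, B (π 0)⁆, B (π 1)⁆, a₂⁆ (B (π 2))))
        + (SymComm.symProd K [a₂, ⁅a₁, B 0⁆, B 1, B 2]
          + SymComm.symProd K [a₂, B 0, ⁅a₁, B 1⁆, B 2]
          + SymComm.symProd K [a₂, B 0, B 1, ⁅a₁, B 2⁆]
          + (1 / 12 : K) • ∑ π : Equiv.Perm (Fin 3),
            (SymComm.diamond K ⁅⁅a₂, B (π 0)⁆, B (π 1)⁆ ⁅a₁, B (π 2)⁆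
              - SymComm.diamond K ⁅⁅⁅a₂, B (π 0)⁆, B (π 1)⁆, a₁⁆ (B (π 2))))) ∧
    -- the general formula
    (∀ k : ℕ, 1 ≤ k → ∀ B : Fin k → A,
      ⁅SymComm.diamond K a₁ a₂, SymComm.symProd K (List.ofFn B)⁆ =
        (∑ i : Fin k, SymComm.symProd K (a₁ :: List.ofFn (Function.update B i ⁅a₂, B i⁆))
          - ∑ h ∈ Finset.Icc 1 (k / 2), (SymComm.coeff h : K) • SymComm.termD K h a₁ a₂ B
          + ∑ h ∈ Finset.Icc 1 ((k - 1) / 2),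
              (SymComm.coeff h : K) • SymComm.termE K h a₁ a₂ B)
        + (∑ i : Fin k, SymComm.symProd K (a₂ :: List.ofFn (Function.update B i ⁅a₁, B i⁆))
          - ∑ h ∈ Finset.Icc 1 (k / 2), (SymComm.coeff h : K) • SymComm.termD K h a₂ a₁ B
          + ∑ h ∈ Finset.Icc 1 ((k - 1) / 2),
              (SymComm.coeff h : K) • SymComm.termE K h a₂ a₁ B)) := by
  refine ⟨fun b₁ b₂ => ?_, fun B => ?_, fun k hk B => SymComm.lie_diamond_symProd hk a₁ a₂ B⟩
  · have h := SymComm.lie_diamond_symProd (K := K) (k := 2) (by omega) a₁ a₂ ![b₁, b₂]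
    have u₁ (c : A) : List.ofFn (Function.update ![b₁, b₂] 0 c) = [c, b₂] := by
      simp [List.ofFn_succ]
    have u₂ (c : A) : List.ofFn (Function.update ![b₁, b₂] 1 c) = [b₁, c] := by
      simp [List.ofFn_succ]
    have p₁ (x y z : A) : SymComm.symProd K [x, y, z] = SymComm.symProd K [y, x, z] :=
      SymComm.symProd_perm (.swap _ _ _)
    have p₂ (x y z : A) : SymComm.symProd K [x, y, z] = SymComm.symProd K [z, x, y] :=
      SymComm.symProd_perm (List.perm_append_comm (l₁ := [x, y]) (l₂ := [z]))
    have l : List.ofFn ![b₁, b₂] = [b₁, b₂] := by simp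
    rw [l, ← SymComm.diamond_eq_symProd] at h
    rw [h]
    simp only [SymComm.halfSide, Fin.sum_univ_two, u₁, u₂, SymComm.termD_one_two,
      show (2 : ℕ) / 2 = 1 from rfl, show ((2 : ℕ) - 1) / 2 = 0 from rfl, Finset.Icc_self,
      Finset.sum_singleton, Finset.Icc_eq_empty_of_lt Nat.zero_lt_one, Finset.sum_empty,
      SymComm.coeff_one, Matrix.cons_val_zero, Matrix.cons_val_one]
    -- The general formula puts `a₁` or `a₂` first, whereas the stated case `k = 2` has the
    -- commutator first.
    rw [p₁ a₁, p₂ a₁, p₁ a₂, p₂ a₂]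
    push_cast
    module
  · have h := SymComm.lie_diamond_symProd (K := K) (k := 3) (by omega) a₁ a₂ B
    have l : List.ofFn B = [B 0, B 1, B 2] := by simp [List.ofFn_succ]
    have u₀ (c : A) : List.ofFn (Function.update B 0 c) = [c, B 1, B 2] := by
      simp [List.ofFn_succ]
    have u₁ (c : A) : List.ofFn (Function.update B 1 c) = [B 0, c, B 2] := by
      simp [List.ofFn_succ]
    have u₂ (c : A) : List.ofFn (Function.update B 2 c) = [B 0, B 1, c] := by
      simp [List.ofFn_succ]
    rw [l] at h
    rw [h]
    simp only [SymComm.halfSide, Fin.sum_univ_three, u₀, u₁, u₂, SymComm.termD_one_three,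
      SymComm.termE_one_three, show (3 : ℕ) / 2 = 1 from rfl, Finset.Icc_self, Finset.sum_singleton,
      SymComm.coeff_one, Finset.sum_sub_distrib]
    push_cast
    module
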